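/- All logarithms are to base 2. Let $P>0$ and consider the AWGN channel $Y_i=X_i+Z_i$ with $Z_i$ i.i.d. $N(0,1)$. A feedback code of block length $n$ has an encoder $X_i=f_i(M,Y^{i-1},V_i)$, where $M$ is the message, $V$ is local randomness of the encoder, and $M$, $Z$, $V$ are independent, and a decoder $\hat M=\phi(Y^n)$. It satisfies the power constraint $P$ if $\frac1n\sum_{i=1}^n E(X_i^2)\le P$. For $M$ uniform on $(0,1)$ let $D^{(n)}=E((M-\phi(Y^n))^2)$ and $E^{(n)}=-\frac1{2n}\log D^{(n)}$. An MSE exponent $E$ is achievable if $E\le\liminf_n E^{(n)}$ for some sequence of codes satisfying the power constraint $P$, and $C_{MMSE}(P)$ is the supremum of the achievable exponents. A rate $R$ is achievable if, for $M$ uniform on a set of $\lceil 2^{nR}\rceil$ elements, some sequence of codes satisfying the power constraint $P$ has $\Pr(\hat M\ne M)\to0$, and $C(P)$ is the supremum of the achievable rates. The instability of a rational filter is $\sum\log|\beta_j|$ over its poles $\beta_j$ with $|\beta_j|>1$. Let $\beta=\sqrt{1+P}$ and $$F(z)=-(\beta^2-1)\frac{\beta^{-1}z^{-1}}{1-\beta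 z^{-1}}.$$ Then: 1. $\beta>1$, and $F$ is strictly causal with exactly one pole, which is simple and equal to $\beta$. $F$ meets the power constraint with equality: $\frac1{2\pi}\int_{-\pi}^{\pi}\left|\frac{F(e^{j\omega})}{1-F(e^{j\omega})}\right|^2d\omega=P$. 2. $C_{MMSE}(P)=C(P)=\frac12\log(1+P)$, and this number is the instability of $F$. 3. $F$, used as an LTI encoder, achieves $C_{MMSE}(P)$. There is a scalar linear system $S_i=aS_{i-1}+bY_{i-1}$, $X_i=cS_i$ (with $Y_0=0$) with transfer function $X(z)/Y(z)=F(z)$ and initial state $S_0=pM+q$, $p\neq0$, such that $E(X_1^2)=P$, where $M$ is uniform on $(0,1)$. For every such system, $E(X_i^2)=P$ for all $i$, so the power constraint holds at every block length, and with suitable decoders $\liminf_n E^{(n)}\ge C_{MMSE}(P)$. 4. The encoders in 3 coincide with the Schalkwijk–Kailath scheme. For every $n$, a feedback encoder of block length $n$ for $M$ uniform on $(0,1)$ is one of the encoders in 3 if and only if $X_1$ is a nonconstant affine function of $M$ with $E(X_1^2)=P$ and $$X_i=\sqrt{1+P}\left(X_{i-1}-\frac{E(X_{i-1}Y_{i-1})}{E(Y_{i-1}^2)}\,Y_{i-1}\right),\qquad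 2\le i\le n.$$ -/

import Mathlib

open MeasureTheory ProbabilityTheory Filter
open scoped ENNReal Matrix

noncomputable section

namespace AWGNFeedback

/-! ## Feedback codes over the additive white Gaussian noise channel -/

/-- A (stochastic) feedback encoder of block length `n`. Index `i : Fin n` is the channel use
number `i + 1`; the transmitted symbol is a function of the message, of the previous channel
outputs and of the local randomness `Vᵢ`. The process `V` takes values in an arbitrary measurable
space and has an arbitrary law. -/
structure Encoder (𝓜 : Type) [MeasurableSpace 𝓜] (n : ℕ) where
  Seed : Type
  seedSpace : MeasurableSpace Seed
  seedLaw : Measure (Fin n → Seed)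
  seedLaw_prob : IsProbabilityMeasure seedLaw
  enc : (i : Fin n) → 𝓜 → (Fin i → ℝ) → Seed → ℝ
  measurable_enc : ∀ i : Fin n,
    Measurable fun p : 𝓜 × (Fin i → ℝ) × Seed => enc i p.1 p.2.1 p.2.2

attribute [instance] Encoder.seedSpace Encoder.seedLaw_prob

namespace Encoder

variable {𝓜 : Type} [MeasurableSpace 𝓜] {n : ℕ}

/-- Sample space: message, noise block, local randomness of the encoder. -/
abbrev Sample (e : Encoder 𝓜 n) : Type := 𝓜 × (Fin n → ℝ) × (Fin n → e.Seed)

/-- Joint law when the message has law `μ`: the noise is i.i.d. `N(0,1)`, and message, noise and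
local randomness are independent. -/
def law (e : Encoder 𝓜 n) (μ : Measure 𝓜) : Measure e.Sample :=
  μ.prod ((Measure.pi fun _ : Fin n => gaussianReal 0 1).prod e.seedLaw)

/-- Channel output `Yᵢ = Xᵢ + Zᵢ` with `Xᵢ = fᵢ(M, Y₁, …, Yᵢ₋₁, Vᵢ)`. -/
def output (e : Encoder 𝓜 n) (i : Fin n) (ω : e.Sample) : ℝ :=
  e.enc i ω.1 (fun k : Fin i => output e ⟨k, k.isLt.trans i.isLt⟩ ω) (ω.2.2 i) + ω.2.1 i
termination_by i.val

/-- Channel input `Xᵢ`. -/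
def input (e : Encoder 𝓜 n) (i : Fin n) (ω : e.Sample) : ℝ :=
  e.enc i ω.1 (fun k : Fin i => e.output ⟨k, k.isLt.trans i.isLt⟩ ω) (ω.2.2 i)

/-- `E(Xᵢ²)`, as an extended nonnegative number. -/
def inputPower (e : Encoder 𝓜 n) (μ : Measure 𝓜) (i : Fin n) : ℝ≥0∞ :=
  ∫⁻ ω, ENNReal.ofReal (e.input i ω ^ 2) ∂(e.law μ)

/-- Block power constraint `(1/n) ∑ᵢ E(Xᵢ²) ≤ P`. -/
def MeetsPower (e : Encoder 𝓜 n) (μ : Measure 𝓜) (P : ℝ) : Prop :=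
  (n : ℝ≥0∞)⁻¹ * ∑ i, e.inputPower μ i ≤ ENNReal.ofReal P

end Encoder

/-- A decoder of block length `n`. -/
structure Decoder (𝓜 : Type) [MeasurableSpace 𝓜] (n : ℕ) where
  dec : (Fin n → ℝ) → 𝓜
  measurable_dec : Measurable dec

/-! ## MSE exponents and the MMSE capacity -/

/-- The message set `(0,1)`. -/
abbrev UnitMsg : Type := Set.Ioo (0 : ℝ) 1

/-- The uniform distribution on `(0,1)`. -/
def unitLaw : Measure UnitMsg := Measure.comap Subtype.val volume

/-- The mean square error `D = E((M - φ(Yⁿ))²)`. -/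
def mse {n : ℕ} (e : Encoder UnitMsg n) (φ : Decoder UnitMsg n) : ℝ :=
  ∫ ω, ((ω.1 : ℝ) - (φ.dec fun i => e.output i ω : ℝ)) ^ 2 ∂(e.law unitLaw)

/-- `E⁽ⁿ⁾ = -(1/(2n)) log₂ D`. -/
def mseExponent {n : ℕ} (e : Encoder UnitMsg n) (φ : Decoder UnitMsg n) : ℝ :=
  -(1 / (2 * (n : ℝ))) * Real.logb 2 (mse e φ)

/-- `E` is an achievable MSE exponent (with feedback) under power constraint `P`. -/
def AchievableExponent (P E : ℝ) : Prop :=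
  ∃ (e : ∀ n, Encoder UnitMsg n) (φ : ∀ n, Decoder UnitMsg n),
    (∀ n, (e n).MeetsPower unitLaw P) ∧
      (E : EReal) ≤ liminf (fun n => (mseExponent (e n) (φ n) : EReal)) atTop

/-- The feedback MMSE capacity: supremum of the achievable MSE exponents. -/
def mmseCapacity (P : ℝ) : EReal :=
  sSup {x : EReal | ∃ E : ℝ, AchievableExponent P E ∧ x = E}

/-! ## Achievable rates and the feedback capacity -/

/-- Number of messages `⌈2^{nR}⌉` at rate `R` and block length `n`. -/
def numMsg (R : ℝ) (n : ℕ) : ℕ := ⌈(2 : ℝ) ^ ((n : ℝ) * R)⌉₊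

/-- The probability of error `P(M ≠ φ(Yⁿ))` for a message uniform on a set of `K` elements. -/
def errorProb {K n : ℕ} (e : Encoder (Fin K) n) (φ : Decoder (Fin K) n) : ℝ≥0∞ :=
  e.law (uniformOn Set.univ) {ω | ω.1 ≠ φ.dec fun i => e.output i ω}

/-- `R` is an achievable rate (with feedback) under power constraint `P`. -/
def AchievableRate (P R : ℝ) : Prop :=
  ∃ (e : ∀ n, Encoder (Fin (numMsg R n)) n) (φ : ∀ n, Decoder (Fin (numMsg R n)) n),
    (∀ n, (e n).MeetsPower (uniformOn Set.univ) P) ∧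
      Tendsto (fun n => errorProb (e n) (φ n)) atTop (nhds 0)

/-- The feedback capacity: supremum of the achievable rates. -/
def feedbackCapacity (P : ℝ) : EReal :=
  sSup {x : EReal | ∃ R : ℝ, AchievableRate P R ∧ x = R}

/-! ## Rational filters -/

/-- The poles in `ℂ` of a rational filter in the variable `z`, with multiplicity. -/
def poles (F : RatFunc ℝ) : Multiset ℂ := (F.denom.map (algebraMap ℝ ℂ)).roots

/-- The filter has an expansion in powers `z⁻¹, z⁻², …`, so that its output at time `i` only
depends on its input before time `i`. -/
def IsStrictlyCausal (F : RatFunc ℝ) : Prop := F.num.degree < F.denom.degree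

open Classical in
/-- The instability: the sum of `log₂ |βⱼ|` over the unstable poles `βⱼ`. -/
def instability (F : RatFunc ℝ) : ℝ :=
  (((poles F).filter fun w => 1 < ‖w‖).map fun w => Real.logb 2 ‖w‖).sum

/-- The value `F(e^{jω})`. -/
def freqResponse (F : RatFunc ℝ) (ω : ℝ) : ℂ :=
  F.eval (algebraMap ℝ ℂ) (Complex.exp (ω * Complex.I))

/-- `(1/2π) ∫ |F(e^{jω}) / (1 - F(e^{jω}))|² S_Z(e^{jω}) dω` over `[-π, π]`. -/
def filterPower (F : RatFunc ℝ) (SZ : ℝ → ℝ) : ℝ :=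
  1 / (2 * Real.pi) *
    ∫ ω in (-Real.pi)..Real.pi, ‖freqResponse F ω / (1 - freqResponse F ω)‖ ^ 2 * SZ ω

/-- `F(z) = -(β² - 1) β⁻¹ z⁻¹ / (1 - β z⁻¹)`. -/
def awgnFilter (β : ℝ) : RatFunc ℝ :=
  -RatFunc.C (β ^ 2 - 1) *
    (RatFunc.C β⁻¹ * RatFunc.X⁻¹ / (1 - RatFunc.C β * RatFunc.X⁻¹))

/-! ## LTI encoders -/

/-- A linear time-invariant system `Sᵢ = A Sᵢ₋₁ + b Yᵢ₋₁` with linear controller `Xᵢ = c Sᵢ`. -/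
structure LTISystem (d : ℕ) where
  A : Matrix (Fin d) (Fin d) ℝ
  b : Fin d → ℝ
  c : Fin d → ℝ

namespace LTISystem

variable {d : ℕ}

/-- The transfer function `X(z)/Y(z) = c (zI - A)⁻¹ b`. -/
def transfer (σ : LTISystem d) : RatFunc ℝ :=
  (fun j => RatFunc.C (σ.c j)) ⬝ᵥ
    ((Matrix.scalar (Fin d) RatFunc.X - σ.A.map RatFunc.C)⁻¹ *ᵥ fun j => RatFunc.C (σ.b j))

/-- The state at time `i + 1` from the initial state `s₀` at time `0` and the outputs at the times
`1, …, i` (there is no output at time `0`). -/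
def state (σ : LTISystem d) (s₀ : Fin d → ℝ) : (i : ℕ) → (Fin i → ℝ) → (Fin d → ℝ)
  | 0, _ => σ.A *ᵥ s₀
  | i + 1, y => σ.A *ᵥ state σ s₀ i (fun k => y k.castSucc) + y (Fin.last i) • σ.b

theorem measurable_state (σ : LTISystem d) (i : ℕ) :
    Measurable fun q : (Fin d → ℝ) × (Fin i → ℝ) => σ.state q.1 i q.2 := by
  have hA : Measurable fun v : Fin d → ℝ => σ.A *ᵥ v :=
    (Continuous.matrix_mulVec continuous_const continuous_id).measurable
  induction i with
  | zero => exact hA.comp measurable_fst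
  | succ i ih =>
    have h1 : Measurable fun q : (Fin d → ℝ) × (Fin (i + 1) → ℝ) =>
        (q.1, fun k : Fin i => q.2 k.castSucc) := by fun_prop
    have h2 : Measurable fun q : (Fin d → ℝ) × (Fin (i + 1) → ℝ) =>
        q.2 (Fin.last i) • σ.b := by fun_prop
    exact (hA.comp (ih.comp h1)).add h2

/-- The transmitted symbol `Xᵢ₊₁ = c Sᵢ₊₁`. -/
def symbol (σ : LTISystem d) (s₀ : Fin d → ℝ) (i : ℕ) (y : Fin i → ℝ) : ℝ :=
  σ.c ⬝ᵥ σ.state s₀ i y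

/-- The LTI encoder of block length `n` with initial state `S₀ = M p + q`. -/
def encoder (σ : LTISystem d) (p q : Fin d → ℝ) (n : ℕ) : Encoder UnitMsg n where
  Seed := Unit
  seedSpace := inferInstance
  seedLaw := Measure.dirac fun _ => ()
  seedLaw_prob := inferInstance
  enc i m y _ := σ.symbol ((m : ℝ) • p + q) i y
  measurable_enc i := by
    have h1 : Measurable fun r : UnitMsg × (Fin i → ℝ) × Unit =>
        ((r.1 : ℝ) • p + q, r.2.1) := by fun_prop
    have h2 : Measurable fun v : Fin d → ℝ => σ.c ⬝ᵥ v :=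
      (Continuous.dotProduct continuous_const continuous_id).measurable
    exact h2.comp ((σ.measurable_state i).comp h1)

/-- The system `σ`, started in `S₀ = M p + q`, is a realization of the filter `F` whose initial
state carries the message and whose first transmission `X₁` has power `P`. -/
def IsRealization (σ : LTISystem d) (p q : Fin d → ℝ) (F : RatFunc ℝ) (P : ℝ) : Prop :=
  σ.transfer = F ∧ p ≠ 0 ∧
    ∫ m : UnitMsg, σ.symbol ((m : ℝ) • p + q) 0 Fin.elim0 ^ 2 ∂unitLaw = P

end LTISystem

/-- The Schalkwijk-Kailath encoder of power `P`: the first symbol is an affine image of the message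
with power `P`, and afterwards
`Xᵢ = √(1+P) (Xᵢ₋₁ - (E(Xᵢ₋₁Yᵢ₋₁) / E(Yᵢ₋₁²)) Yᵢ₋₁)`,
the scaled error of the linear MMSE estimate of `Xᵢ₋₁` from `Yᵢ₋₁`. -/
def Encoder.IsSchalkwijkKailath {n : ℕ} (e : Encoder UnitMsg n) (P : ℝ) : Prop :=
  (∃ a b : ℝ, a ≠ 0 ∧ ∫ m : UnitMsg, (a * (m : ℝ) + b) ^ 2 ∂unitLaw = P ∧
    ∀ (h : 0 < n) (ω : e.Sample), e.input ⟨0, h⟩ ω = a * (ω.1 : ℝ) + b) ∧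
  ∀ (i : ℕ) (h : i + 1 < n) (ω : e.Sample),
    e.input ⟨i + 1, h⟩ ω = Real.sqrt (1 + P) *
      (e.input ⟨i, Nat.lt_of_succ_lt h⟩ ω -
        (∫ ω', e.input ⟨i, Nat.lt_of_succ_lt h⟩ ω' * e.output ⟨i, Nat.lt_of_succ_lt h⟩ ω'
            ∂(e.law unitLaw)) /
          (∫ ω', e.output ⟨i, Nat.lt_of_succ_lt h⟩ ω' ^ 2 ∂(e.law unitLaw)) *
          e.output ⟨i, Nat.lt_of_succ_lt h⟩ ω)

end AWGNFeedback

end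

namespace AWGNFeedback

/-! ## Basic properties of feedback encoders -/

namespace Encoder

variable {𝓜 : Type} [MeasurableSpace 𝓜] {n : ℕ}

/-! Converse. Fix message and seed. The map from noise to outputs is then triangular, each output
being a translate of its noise sample, so the product of one-dimensional density ratios turns the
noise law into i.i.d. `N(0, 1 + P)`, whatever the encoder (`lintegral_causalOutput`,
`lintegral_mul_gaussianRatio`). Under the tilted law the message is independent of the outputs.
Jensen's inequality gives `ofReal_exp_integral_sub_le`: for a test function `g` of message and
outputs, `exp (E g - (n/2) log (1 + P))` is at most the mean of `exp g` under the product law.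
Taking `g` to be minus a multiple of the squared error bounds the MSE below by a constant times `(1
+ P)⁻ⁿ`; taking `g = log K` on correct decoding gives a Fano inequality.

Achievability. Put `s = √(1 + P)`, `t = P / s` and send `Xᵢ₊₁ = s Xᵢ - t Yᵢ`. Since `Zᵢ` is
uncorrelated with `Xᵢ` and `s - t = 1 / s`, the power obeys `E Xᵢ₊₁² = E Xᵢ² / (1 + P) + P² / (1 +
P)`, with fixed point `P`. Unrolling, the symbol after `n` uses is `sⁿ X₁` plus a function of the
outputs, so the receiver knows `X₁` up to mean square error at most `P / (1 + P)ⁿ`. No Gaussianity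
of the input is needed.

Filter and coincidence. `F` is a constant over `z - β`, and `F / (1 - F)` has its pole at `1 / β`,
so its squared modulus on the circle is a multiple of a Poisson kernel. A scalar realization of `F`
generates exactly the recursion above, and at input power `P` the linear MMSE coefficient is `P / (1
+ P)`, which makes the Schalkwijk–Kailath recursion the same one. -/

theorem output_eq (e : Encoder 𝓜 n) (i : Fin n) (ω : e.Sample) :
    e.output i ω = e.input i ω + ω.2.1 i := by
  rw [output, input]

theorem measurable_input_of_lt (e : Encoder 𝓜 n) (i : Fin n)
    (h : ∀ k : Fin n, k < i → Measurable (e.output k)) : Measurable (e.input i) := by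
  have h1 : Measurable fun ω : e.Sample =>
      (ω.1, (fun k : Fin i => e.output ⟨k, k.isLt.trans i.isLt⟩ ω), ω.2.2 i) := by
    refine measurable_fst.prodMk (Measurable.prodMk ?_ ?_)
    · exact measurable_pi_lambda _ fun k => h _ k.isLt
    · fun_prop
  exact (e.measurable_enc i).comp h1

theorem measurable_output (e : Encoder 𝓜 n) (i : Fin n) : Measurable (e.output i) := by
  induction i using WellFoundedLT.induction with
  | ind i ih =>
    have h := e.measurable_input_of_lt i ih
    have h2 : Measurable fun ω : e.Sample => ω.2.1 i := by fun_prop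
    exact (funext (e.output_eq i) : e.output i = _) ▸ h.add h2

theorem measurable_input (e : Encoder 𝓜 n) (i : Fin n) : Measurable (e.input i) :=
  e.measurable_input_of_lt i fun k _ => e.measurable_output k

instance (e : Encoder 𝓜 n) (μ : Measure 𝓜) [IsProbabilityMeasure μ] :
    IsProbabilityMeasure (e.law μ) := by
  unfold law; infer_instance

/-- The output at time `i` does not depend on later noise. -/
theorem output_congr (e : Encoder 𝓜 n) (i : Fin n) (m : 𝓜) (z z' : Fin n → ℝ)
    (v : Fin n → e.Seed) (h : ∀ k ≤ i, z k = z' k) :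
    e.output i (m, z, v) = e.output i (m, z', v) := by
  induction i using WellFoundedLT.induction with
  | ind i ih =>
    rw [output, output]
    refine congrArg₂ (· + ·) (congrArg (fun y => e.enc i m y (v i)) (funext fun k => ?_))
      (h i le_rfl)
    exact ih ⟨k, _⟩ k.isLt fun l hl => h l (hl.trans (le_of_lt k.isLt))

theorem input_congr (e : Encoder 𝓜 n) (i : Fin n) (m : 𝓜) (z z' : Fin n → ℝ)
    (v : Fin n → e.Seed) (h : ∀ k < i, z k = z' k) :
    e.input i (m, z, v) = e.input i (m, z', v) := by
  unfold input
  congr 1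
  funext k
  exact e.output_congr ⟨k, _⟩ m z z' v fun l hl => h l (lt_of_le_of_lt hl k.isLt)

theorem measurePreserving_noise (e : Encoder 𝓜 n) (μ : Measure 𝓜) [IsProbabilityMeasure μ]
    (i : Fin n) : MeasurePreserving (fun ω : e.Sample => ω.2.1 i) (e.law μ) (gaussianReal 0 1) :=
  (measurePreserving_eval (fun _ : Fin n => gaussianReal 0 1) i).comp
    (measurePreserving_fst.comp measurePreserving_snd)

theorem memLp_noise (e : Encoder 𝓜 n) (μ : Measure 𝓜) [IsProbabilityMeasure μ] (i : Fin n) :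
    MemLp (fun ω : e.Sample => ω.2.1 i) 2 (e.law μ) :=
  (memLp_id_gaussianReal' 2 (by simp)).comp_measurePreserving (e.measurePreserving_noise μ i)

theorem integral_noise_sq (e : Encoder 𝓜 n) (μ : Measure 𝓜) [IsProbabilityMeasure μ] (i : Fin n) :
    ∫ ω, ω.2.1 i ^ 2 ∂(e.law μ) = 1 := by
  have h1 : ∫ x, x ^ 2 ∂(gaussianReal 0 1) = 1 := by
    have h := variance_id_gaussianReal (μ := 0) (v := 1)
    rw [variance_of_integral_eq_zero (by fun_prop) (by simp)] at h
    simpa using h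
  rw [← h1, ← (e.measurePreserving_noise μ i).map_eq, integral_map (by fun_prop) (by fun_prop)]

/-- Reversing the sign of the noise at time `i` preserves the joint law. -/
theorem measurePreserving_flip (e : Encoder 𝓜 n) (μ : Measure 𝓜) [IsProbabilityMeasure μ]
    (i : Fin n) :
    MeasurePreserving (fun ω : e.Sample =>
      (ω.1, (fun k => if k = i then -ω.2.1 k else ω.2.1 k), ω.2.2)) (e.law μ) (e.law μ) := by
  have h : MeasurePreserving (fun (z : Fin n → ℝ) k => if k = i then -z k else z k)
      (Measure.pi fun _ => gaussianReal 0 1) (Measure.pi fun _ => gaussianReal 0 1) := by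
    refine measurePreserving_pi (fun _ => gaussianReal 0 1) (fun _ => gaussianReal 0 1)
      (f := fun k x => if k = i then -x else x) fun k => ?_
    by_cases hk : k = i
    · simp only [hk, if_true]
      exact ⟨measurable_neg, by rw [gaussianReal_map_neg, neg_zero]⟩
    · simp only [hk, if_false]
      exact MeasurePreserving.id _
  exact (MeasurePreserving.id μ).prod (h.prod (MeasurePreserving.id e.seedLaw))

/-- Flipping the sign of the current noise preserves the law and leaves the input unchanged, by
causality, so the integral equals its own negative. This argument needs no integrability. -/
theorem integral_input_mul_noise (e : Encoder 𝓜 n) (μ : Measure 𝓜) [IsProbabilityMeasure μ]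
    (i : Fin n) : ∫ ω, e.input i ω * ω.2.1 i ∂(e.law μ) = 0 := by
  have hf := e.measurePreserving_flip μ i
  have hm : Measurable fun ω : e.Sample => e.input i ω * ω.2.1 i :=
    (e.measurable_input i).mul (by fun_prop)
  have h : ∫ ω, e.input i ω * ω.2.1 i ∂(e.law μ) = ∫ ω, -(e.input i ω * ω.2.1 i) ∂(e.law μ) := by
    conv_lhs => rw [← hf.map_eq]
    rw [integral_map hf.measurable.aemeasurable hm.aestronglyMeasurable]
    refine integral_congr_ae (ae_of_all _ fun ω => ?_)
    have := e.input_congr i ω.1 (fun k => if k = i then -ω.2.1 k else ω.2.1 k) ω.2.1 ω.2.2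
      fun k hk => by simp [hk.ne]
    simp [this]
  rw [integral_neg] at h
  linarith

theorem memLp_output (e : Encoder 𝓜 n) (μ : Measure 𝓜) [IsProbabilityMeasure μ] {i : Fin n}
    (h : MemLp (e.input i) 2 (e.law μ)) : MemLp (e.output i) 2 (e.law μ) := by
  have := h.add (e.memLp_noise μ i)
  exact this.ae_eq (ae_of_all _ fun ω => (e.output_eq i ω).symm)

/-- The power of a linear combination of the input and the output at time `i`. -/
theorem integral_sub_output_sq (e : Encoder 𝓜 n) (μ : Measure 𝓜) [IsProbabilityMeasure μ]
    {i : Fin n} (h : MemLp (e.input i) 2 (e.law μ)) (s t : ℝ) :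
    ∫ ω, (s * e.input i ω - t * e.output i ω) ^ 2 ∂(e.law μ) =
      (s - t) ^ 2 * ∫ ω, e.input i ω ^ 2 ∂(e.law μ) + t ^ 2 := by
  have hz := e.memLp_noise μ i
  have hxz : Integrable (fun ω => e.input i ω * ω.2.1 i) (e.law μ) := h.integrable_mul hz
  have h1 : Integrable (fun ω => (s - t) ^ 2 * e.input i ω ^ 2) (e.law μ) :=
    h.integrable_sq.const_mul _
  have h2 : Integrable (fun ω => -2 * (s - t) * t * (e.input i ω * ω.2.1 i)) (e.law μ) :=
    hxz.const_mul _
  have h3 : Integrable (fun ω : e.Sample => t ^ 2 * ω.2.1 i ^ 2) (e.law μ) :=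
    hz.integrable_sq.const_mul _
  have h12 : Integrable (fun ω => (s - t) ^ 2 * e.input i ω ^ 2 +
    -2 * (s - t) * t * (e.input i ω * ω.2.1 i)) (e.law μ) := h1.add h2
  have : ∀ ω, (s * e.input i ω - t * e.output i ω) ^ 2 = ((s - t) ^ 2 * e.input i ω ^ 2 +
      -2 * (s - t) * t * (e.input i ω * ω.2.1 i)) + t ^ 2 * ω.2.1 i ^ 2 := fun ω => by
    rw [output_eq]; ring
  simp_rw [this]
  rw [integral_add h12 h3, integral_add h1 h2, integral_const_mul, integral_const_mul,
    integral_const_mul, integral_input_mul_noise, integral_noise_sq]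
  ring

theorem integral_output_sq (e : Encoder 𝓜 n) (μ : Measure 𝓜) [IsProbabilityMeasure μ] {i : Fin n}
    (h : MemLp (e.input i) 2 (e.law μ)) :
    ∫ ω, e.output i ω ^ 2 ∂(e.law μ) = ∫ ω, e.input i ω ^ 2 ∂(e.law μ) + 1 := by
  simpa using e.integral_sub_output_sq μ h 0 (-1)

theorem integral_input_mul_output (e : Encoder 𝓜 n) (μ : Measure 𝓜) [IsProbabilityMeasure μ]
    {i : Fin n} (h : MemLp (e.input i) 2 (e.law μ)) :
    ∫ ω, e.input i ω * e.output i ω ∂(e.law μ) = ∫ ω, e.input i ω ^ 2 ∂(e.law μ) := by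
  have hz := e.memLp_noise μ i
  have hxz : Integrable (fun ω => e.input i ω * ω.2.1 i) (e.law μ) := h.integrable_mul hz
  have : ∀ ω, e.input i ω * e.output i ω = e.input i ω ^ 2 + e.input i ω * ω.2.1 i := fun ω => by
    rw [output_eq]; ring
  simp_rw [this]
  rw [integral_add h.integrable_sq hxz, integral_input_mul_noise, add_zero]

theorem memLp_sub_output (e : Encoder 𝓜 n) (μ : Measure 𝓜) [IsProbabilityMeasure μ]
    {i : Fin n} (h : MemLp (e.input i) 2 (e.law μ)) (s t : ℝ) :
    MemLp (fun ω => s * e.input i ω - t * e.output i ω) 2 (e.law μ) :=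
  (h.const_mul s).sub ((e.memLp_output μ h).const_mul t)

theorem memLp_input_of_inputPower_ne_top (e : Encoder 𝓜 n) (μ : Measure 𝓜) {i : Fin n}
    (h : e.inputPower μ i ≠ ∞) : MemLp (e.input i) 2 (e.law μ) := by
  refine (memLp_two_iff_integrable_sq (e.measurable_input i).aestronglyMeasurable).2
    ⟨((e.measurable_input i).pow_const 2).aestronglyMeasurable, ?_⟩
  rw [hasFiniteIntegral_iff_ofReal (ae_of_all _ fun ω => sq_nonneg _)]
  exact lt_of_le_of_ne le_top h

theorem inputPower_eq_ofReal (e : Encoder 𝓜 n) (μ : Measure 𝓜) {i : Fin n}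
    (h : MemLp (e.input i) 2 (e.law μ)) :
    e.inputPower μ i = ENNReal.ofReal (∫ ω, e.input i ω ^ 2 ∂(e.law μ)) :=
  (ofReal_integral_eq_lintegral_ofReal h.integrable_sq (ae_of_all _ fun _ => sq_nonneg _)).symm

theorem meetsPower_of_forall_le (e : Encoder 𝓜 n) (μ : Measure 𝓜) {P : ℝ}
    (h : ∀ i, e.inputPower μ i ≤ ENNReal.ofReal P) : e.MeetsPower μ P := by
  unfold MeetsPower
  rcases Nat.eq_zero_or_pos n with rfl | hn
  -- At block length zero the sum is empty, and `∞ * 0 = 0`.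
  · simp
  calc (n : ℝ≥0∞)⁻¹ * ∑ i, e.inputPower μ i
      ≤ (n : ℝ≥0∞)⁻¹ * ∑ _i : Fin n, ENNReal.ofReal P := by gcongr with i; exact h i
    _ = ENNReal.ofReal P := by
      rw [Finset.sum_const, Finset.card_univ, Fintype.card_fin, nsmul_eq_mul, ← mul_assoc,
        ENNReal.inv_mul_cancel (by simpa using hn.ne') (by simp), one_mul]

theorem MeetsPower.memLp_input {e : Encoder 𝓜 n} {μ : Measure 𝓜} {P : ℝ} (h : e.MeetsPower μ P)
    (i : Fin n) : MemLp (e.input i) 2 (e.law μ) := by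
  refine e.memLp_input_of_inputPower_ne_top μ fun hi => ?_
  have hs : ∑ i, e.inputPower μ i = ∞ :=
    ENNReal.sum_eq_top.2 ⟨i, Finset.mem_univ i, hi⟩
  unfold MeetsPower at h
  rw [hs, ENNReal.mul_top (by simp)] at h
  exact absurd h (by simp)

theorem MeetsPower.sum_le {e : Encoder 𝓜 n} {μ : Measure 𝓜} {P : ℝ} (hP : 0 ≤ P)
    (h : e.MeetsPower μ P) : ∑ i, ∫ ω, e.input i ω ^ 2 ∂(e.law μ) ≤ n * P := by
  rcases Nat.eq_zero_or_pos n with rfl | hn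
  · simp
  have h1 : ∑ i, e.inputPower μ i =
      ENNReal.ofReal (∑ i, ∫ ω, e.input i ω ^ 2 ∂(e.law μ)) := by
    rw [ENNReal.ofReal_sum_of_nonneg fun i _ => integral_nonneg fun ω => sq_nonneg _]
    exact Finset.sum_congr rfl fun i _ => e.inputPower_eq_ofReal μ (h.memLp_input i)
  unfold MeetsPower at h
  rw [ENNReal.inv_mul_le_iff (by simpa using hn.ne') (by simp), h1,
    ← ENNReal.ofReal_natCast, ← ENNReal.ofReal_mul (by positivity)] at h
  exact (ENNReal.ofReal_le_ofReal_iff (by positivity)).1 h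

end Encoder

/-! ## Change of measure on the channel outputs -/

/-- Outputs of the additive channel with noise `z` when the symbol sent at time `i + 1` is `f i`
of the previous outputs. -/
def causalOutput (f : (i : ℕ) → (Fin i → ℝ) → ℝ) : (n : ℕ) → (Fin n → ℝ) → Fin n → ℝ
  | 0, _ => Fin.elim0
  | n + 1, z =>
    Fin.snoc (causalOutput f n fun k => z k.castSucc)
      (f n (causalOutput f n fun k => z k.castSucc) + z (Fin.last n))

theorem causalOutput_apply (f : (i : ℕ) → (Fin i → ℝ) → ℝ) (n : ℕ) (z : Fin n → ℝ) (i : Fin n) :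
    causalOutput f n z i =
      f i (fun k : Fin i => causalOutput f n z ⟨k, k.isLt.trans i.isLt⟩) + z i := by
  induction n with
  | zero => exact i.elim0
  | succ n ih =>
    refine Fin.lastCases ?_ (fun i => ?_) i
    · rw [causalOutput, Fin.snoc_last]
      congr 2
      funext k
      exact (Fin.snoc_castSucc (α := fun _ => ℝ) _ _ k).symm
    · rw [causalOutput, Fin.snoc_castSucc, ih]
      congr 2
      funext k
      exact (Fin.snoc_castSucc (α := fun _ => ℝ) _ _ (⟨k, k.isLt.trans i.isLt⟩ : Fin n)).symm

theorem measurable_snoc {n : ℕ} :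
    Measurable fun p : (Fin n → ℝ) × ℝ => (Fin.snoc p.1 p.2 : Fin (n + 1) → ℝ) := by
  refine measurable_pi_lambda _ fun i => ?_
  refine Fin.lastCases ?_ (fun i => ?_) i
  · simpa using measurable_snd
  · simp only [Fin.snoc_castSucc]
    fun_prop

theorem measurable_causalOutput {f : (i : ℕ) → (Fin i → ℝ) → ℝ} (hf : ∀ i, Measurable (f i))
    (n : ℕ) : Measurable (causalOutput f n) := by
  induction n with
  | zero => exact measurable_of_finite _
  | succ n ih =>
    have h : Measurable fun z : Fin (n + 1) → ℝ => causalOutput f n fun k => z k.castSucc :=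
      ih.comp (by fun_prop)
    exact measurable_snoc.comp
      (h.prodMk (((hf n).comp h).add (measurable_pi_apply (Fin.last n))))

theorem lintegral_pi_snoc (n : ℕ) (γ : Measure ℝ) [SigmaFinite γ] {H : (Fin (n + 1) → ℝ) → ℝ≥0∞}
    (hH : Measurable H) :
    ∫⁻ z, H z ∂(Measure.pi fun _ => γ) =
      ∫⁻ z : Fin n → ℝ, ∫⁻ x, H (Fin.snoc z x) ∂γ ∂(Measure.pi fun _ => γ) := by
  have h := (measurePreserving_piFinSuccAbove (fun _ : Fin (n + 1) => γ) (Fin.last n)).symm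
  rw [← h.lintegral_comp hH]
  refine (lintegral_prod_symm _ (hH.comp h.measurable).aemeasurable).trans ?_
  refine lintegral_congr fun z => lintegral_congr fun x => congrArg H ?_
  exact Fin.insertNth_last' x z

/-- If each translate of `γ` is turned into `ν` by the density `r`, then the noise law `γ^n` is
turned into the output law `ν^n` by the product of the densities. -/
theorem lintegral_causalOutput {γ ν : Measure ℝ} [SigmaFinite γ] [SigmaFinite ν]
    {r : ℝ → ℝ → ℝ≥0∞} (hr : Measurable (Function.uncurry r))
    (hrν : ∀ (x : ℝ) (h : ℝ → ℝ≥0∞), Measurable h →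
      ∫⁻ z, h (x + z) * r z (x + z) ∂γ = ∫⁻ y, h y ∂ν)
    {f : (i : ℕ) → (Fin i → ℝ) → ℝ} (hf : ∀ i, Measurable (f i)) (n : ℕ)
    {H : (Fin n → ℝ) → ℝ≥0∞} (hH : Measurable H) :
    ∫⁻ z, H (causalOutput f n z) * ∏ i, r (z i) (causalOutput f n z i) ∂(Measure.pi fun _ => γ) =
      ∫⁻ y, H y ∂(Measure.pi fun _ => ν) := by
  induction n with
  | zero =>
    simp only [Finset.univ_eq_empty, Finset.prod_empty, mul_one]
    have h0 : (Measure.pi fun _ : Fin 0 => γ) = Measure.pi fun _ => ν := by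
      rw [Measure.pi_of_empty, Measure.pi_of_empty]
    rw [h0]
    exact lintegral_congr fun z => congrArg H (Subsingleton.elim _ _)
  | succ n ih =>
    have hT := measurable_causalOutput hf n
    have hT' := measurable_causalOutput hf (n + 1)
    rw [lintegral_pi_snoc n ν hH, lintegral_pi_snoc n γ]
    -- The last output is integrated out under `ν` before the induction hypothesis is applied. Given
    -- the earlier noises the last symbol is a constant, so `hrν` applies with that constant as the
    -- shift.
    · rw [← ih (H := fun y => ∫⁻ x, H (Fin.snoc y x) ∂ν)
        (Measurable.lintegral_prod_right' (hH.comp measurable_snoc))]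
      refine lintegral_congr fun z => ?_
      have hHz : Measurable fun x => H (Fin.snoc (causalOutput f n z) x) :=
        hH.comp (measurable_snoc.comp (measurable_const.prodMk measurable_id))
      rw [← hrν (f n (causalOutput f n z)) _ hHz, ← lintegral_mul_const]
      · refine lintegral_congr fun x => ?_
        simp only [causalOutput, Fin.prod_univ_castSucc, Fin.snoc_castSucc, Fin.snoc_last]
        ring
      · refine Measurable.mul ?_ ?_
        · exact hHz.comp (by fun_prop)
        · exact hr.comp (measurable_id.prodMk (by fun_prop))
    · refine (hH.comp hT').mul (Finset.measurable_prod _ fun i _ => ?_)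
      exact hr.comp ((measurable_pi_apply i).prodMk ((measurable_pi_apply i).comp hT'))

/-- The density `dN(0, 1 + P) / dN(0, 1)` between the output `y` and the noise `z`. -/
noncomputable def gaussianRatio (P z y : ℝ) : ℝ :=
  Real.exp (-(1 / 2 * Real.log (1 + P) + y ^ 2 / (2 * (1 + P)) - z ^ 2 / 2))

/-- Lebesgue measure is translation invariant, and `gaussianRatio` is the quotient of the two
Gaussian densities, one evaluated at the output and the other at the noise. -/
theorem lintegral_gaussianRatio {P : ℝ} (hP : 0 < P) (x : ℝ) {h : ℝ → ℝ≥0∞} (hh : Measurable h) :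
    ∫⁻ z, h (x + z) * ENNReal.ofReal (gaussianRatio P z (x + z)) ∂(gaussianReal 0 1) =
      ∫⁻ y, h y ∂(gaussianReal 0 (1 + P).toNNReal) := by
  have hP1 : (0 : ℝ) < 1 + P := by linarith
  have hv : (1 + P).toNNReal ≠ 0 := by simpa using hP1
  have hm : Measurable fun z => h (x + z) * ENNReal.ofReal (gaussianRatio P z (x + z)) := by
    unfold gaussianRatio; fun_prop
  rw [gaussianReal_of_var_ne_zero _ one_ne_zero, gaussianReal_of_var_ne_zero _ hv,
    lintegral_withDensity_eq_lintegral_mul _ (measurable_gaussianPDF 0 1)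
      hm,
    lintegral_withDensity_eq_lintegral_mul _ (measurable_gaussianPDF 0 _) hh,
    ← lintegral_add_left_eq_self (gaussianPDF 0 (1 + P).toNNReal * h) x]
  refine lintegral_congr fun z => ?_
  have key : gaussianPDFReal 0 1 z * gaussianRatio P z (x + z) =
      gaussianPDFReal 0 (1 + P).toNNReal (x + z) := by
    simp only [gaussianPDFReal, gaussianRatio, Real.coe_toNNReal _ hP1.le, NNReal.coe_one, sub_zero]
    have h1 : Real.exp (-(1 / 2 * Real.log (1 + P))) = (√(1 + P))⁻¹ := by
      rw [Real.exp_neg, Real.sqrt_eq_rpow, Real.rpow_def_of_pos hP1, mul_comm]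
    rw [show -(1 / 2 * Real.log (1 + P) + (x + z) ^ 2 / (2 * (1 + P)) - z ^ 2 / 2) =
      -(1 / 2 * Real.log (1 + P)) + (-(x + z) ^ 2 / (2 * (1 + P)) + z ^ 2 / 2) by ring,
      Real.exp_add, h1, Real.exp_add, Real.sqrt_mul (by positivity) (1 + P), mul_inv, mul_one,
      show -z ^ 2 / (2 * 1) = -(z ^ 2 / 2) by ring, Real.exp_neg (z ^ 2 / 2)]
    have := Real.exp_ne_zero (z ^ 2 / 2)
    field_simp
  simp only [Pi.mul_apply, gaussianPDF]
  rw [← key, ENNReal.ofReal_mul (gaussianPDFReal_nonneg _ _ _)]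
  ring

/-! ## Converse bounds -/

/-- Jensen's inequality for `exp`. With the right side in `ℝ≥0∞`, integrability of `exp W` need not
be assumed: otherwise the bound is trivial. -/
theorem ofReal_exp_integral_le_lintegral {Ω : Type*} [MeasurableSpace Ω] {μ : Measure Ω}
    [IsProbabilityMeasure μ] {W : Ω → ℝ} (hW : Integrable W μ) :
    ENNReal.ofReal (Real.exp (∫ ω, W ω ∂μ)) ≤ ∫⁻ ω, ENNReal.ofReal (Real.exp (W ω)) ∂μ := by
  have hm : AEStronglyMeasurable (fun ω => Real.exp (W ω)) μ :=
    Real.continuous_exp.comp_aestronglyMeasurable hW.aestronglyMeasurable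
  by_cases htop : ∫⁻ ω, ENNReal.ofReal (Real.exp (W ω)) ∂μ = ∞
  · rw [htop]; exact le_top
  have hi : Integrable (fun ω => Real.exp (W ω)) μ := by
    refine ⟨hm, ?_⟩
    rw [hasFiniteIntegral_iff_ofReal (ae_of_all _ fun ω => (Real.exp_pos _).le)]
    exact lt_of_le_of_ne le_top htop
  rw [← ofReal_integral_eq_lintegral_ofReal hi (ae_of_all _ fun ω => (Real.exp_pos _).le)]
  exact ENNReal.ofReal_le_ofReal
    (convexOn_exp.map_integral_le Real.continuous_exp.continuousOn isClosed_univ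
      (ae_of_all _ fun _ => Set.mem_univ _) hW hi)

namespace Encoder

variable {𝓜 : Type} [MeasurableSpace 𝓜] {n : ℕ}

/-- The encoding functions once message and local randomness are fixed, extended by zero. -/
def symbolMap (e : Encoder 𝓜 n) (m : 𝓜) (v : Fin n → e.Seed) (i : ℕ) (y : Fin i → ℝ) : ℝ :=
  if h : i < n then e.enc ⟨i, h⟩ m y (v ⟨i, h⟩) else 0

theorem measurable_symbolMap (e : Encoder 𝓜 n) (m : 𝓜) (v : Fin n → e.Seed) (i : ℕ) :
    Measurable (e.symbolMap m v i) := by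
  unfold symbolMap
  by_cases h : i < n
  · simp only [h, dif_pos]
    exact (e.measurable_enc ⟨i, h⟩).comp
      (measurable_const.prodMk (measurable_id.prodMk measurable_const))
  · simp only [h, dif_neg, not_false_eq_true]
    exact measurable_const

theorem output_eq_causalOutput (e : Encoder 𝓜 n) (m : 𝓜) (z : Fin n → ℝ) (v : Fin n → e.Seed)
    (i : Fin n) : e.output i (m, z, v) = causalOutput (e.symbolMap m v) n z i := by
  induction i using WellFoundedLT.induction with
  | ind i ih =>
    rw [causalOutput_apply, output]
    simp only [symbolMap, i.isLt, dif_pos]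
    refine congrArg (· + _) (congrArg (fun y => e.enc i m y (v i)) (funext fun k => ?_))
    exact ih ⟨k, _⟩ k.isLt

theorem measurable_outputs (e : Encoder 𝓜 n) : Measurable fun ω : e.Sample => fun i => e.output i ω :=
  measurable_pi_lambda _ e.measurable_output

theorem lintegral_law (e : Encoder 𝓜 n) (μ : Measure 𝓜) [IsProbabilityMeasure μ]
    {G : e.Sample → ℝ≥0∞} (hG : Measurable G) :
    ∫⁻ ω, G ω ∂(e.law μ) = ∫⁻ m, ∫⁻ v, ∫⁻ z, G (m, z, v)
      ∂(Measure.pi fun _ : Fin n => gaussianReal 0 1) ∂e.seedLaw ∂μ := by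
  unfold law
  rw [lintegral_prod _ hG.aemeasurable]
  exact lintegral_congr fun m => lintegral_prod_symm _ (hG.comp measurable_prodMk_left).aemeasurable

/-- Under the tilted law the outputs are i.i.d. `N(0, 1 + P)` and independent of the message. -/
theorem lintegral_mul_gaussianRatio (e : Encoder 𝓜 n) (μ : Measure 𝓜) [IsProbabilityMeasure μ]
    {P : ℝ} (hP : 0 < P) {H : 𝓜 → (Fin n → ℝ) → ℝ≥0∞} (hH : Measurable (Function.uncurry H)) :
    ∫⁻ ω, H ω.1 (fun i => e.output i ω) *
        ∏ i, ENNReal.ofReal (gaussianRatio P (ω.2.1 i) (e.output i ω)) ∂(e.law μ) =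
      ∫⁻ m, ∫⁻ y, H m y ∂(Measure.pi fun _ => gaussianReal 0 (1 + P).toNNReal) ∂μ := by
  have hr : Measurable (Function.uncurry fun z y => ENNReal.ofReal (gaussianRatio P z y)) := by
    unfold gaussianRatio Function.uncurry; fun_prop
  have hm : Measurable fun ω : e.Sample => H ω.1 (fun i => e.output i ω) *
      ∏ i, ENNReal.ofReal (gaussianRatio P (ω.2.1 i) (e.output i ω)) := by
    refine (hH.comp (measurable_fst.prodMk e.measurable_outputs)).mul
      (Finset.measurable_prod _ fun i _ => ?_)
    have hy := e.measurable_output i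
    unfold gaussianRatio
    fun_prop
  rw [e.lintegral_law μ hm]
  refine lintegral_congr fun m => ?_
  have hinner : ∀ v : Fin n → e.Seed,
      ∫⁻ z, H m (fun i => e.output i (m, z, v)) *
        ∏ i, ENNReal.ofReal (gaussianRatio P (z i) (e.output i (m, z, v)))
          ∂(Measure.pi fun _ : Fin n => gaussianReal 0 1) =
      ∫⁻ y, H m y ∂(Measure.pi fun _ => gaussianReal 0 (1 + P).toNNReal) := fun v => by
    simp only [output_eq_causalOutput]
    exact lintegral_causalOutput hr (fun x h hh => lintegral_gaussianRatio hP x hh)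
      (e.measurable_symbolMap m v) n (hH.comp measurable_prodMk_left)
  calc _ = ∫⁻ _v, ∫⁻ y, H m y ∂(Measure.pi fun _ => gaussianReal 0 (1 + P).toNNReal)
          ∂e.seedLaw := lintegral_congr hinner
    _ = _ := by rw [lintegral_const, measure_univ, mul_one]

/-- The variational (Donsker-Varadhan) form of the bound `I(M; Yⁿ) ≤ (n/2) log(1 + P)`. -/
theorem ofReal_exp_integral_sub_le (e : Encoder 𝓜 n) (μ : Measure 𝓜) [IsProbabilityMeasure μ]
    {P : ℝ} (hP : 0 < P) (he : e.MeetsPower μ P) {g : 𝓜 → (Fin n → ℝ) → ℝ}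
    (hg : Measurable (Function.uncurry g))
    (hgi : Integrable (fun ω => g ω.1 fun i => e.output i ω) (e.law μ)) :
    ENNReal.ofReal (Real.exp ((∫ ω, g ω.1 (fun i => e.output i ω) ∂(e.law μ)) -
        n / 2 * Real.log (1 + P))) ≤
      ∫⁻ m, ∫⁻ y, ENNReal.ofReal (Real.exp (g m y))
        ∂(Measure.pi fun _ => gaussianReal 0 (1 + P).toNNReal) ∂μ := by
  have hP1 : (0 : ℝ) < 1 + P := by linarith
  have hX := he.memLp_input
  have hY := fun i => e.memLp_output μ (hX i)
  have hZ := e.memLp_noise μ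
  -- `ℓ i` is minus the logarithm of the density ratio at time `i`. Its mean exceeds `½ log (1 + P)`
  -- by a multiple of `E Xᵢ² - P`, and the power constraint makes these excesses sum to at most
  -- zero.
  let ℓ : Fin n → e.Sample → ℝ := fun i ω =>
    1 / 2 * Real.log (1 + P) + (e.output i ω ^ 2 / (2 * (1 + P)) - ω.2.1 i ^ 2 / 2)
  have hd1 : ∀ i, Integrable (fun ω => e.output i ω ^ 2 / (2 * (1 + P))) (e.law μ) :=
    fun i => (hY i).integrable_sq.div_const _
  have hd2 : ∀ i, Integrable (fun ω : e.Sample => ω.2.1 i ^ 2 / 2) (e.law μ) :=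
    fun i => (hZ i).integrable_sq.div_const _
  have hd : ∀ i, Integrable (fun ω => e.output i ω ^ 2 / (2 * (1 + P)) - ω.2.1 i ^ 2 / 2)
    (e.law μ) := fun i => (hd1 i).sub (hd2 i)
  have hℓ : ∀ i, Integrable (ℓ i) (e.law μ) := fun i => (integrable_const _).add (hd i)
  have hℓv : ∀ i, ∫ ω, ℓ i ω ∂(e.law μ) = 1 / 2 * Real.log (1 + P) +
      ((∫ ω, e.input i ω ^ 2 ∂(e.law μ)) - P) / (2 * (1 + P)) := fun i => by
    simp only [ℓ]
    rw [integral_add (integrable_const _) (hd i), integral_sub (hd1 i) (hd2 i), integral_div,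
      integral_div, e.integral_output_sq μ (hX i), integral_noise_sq, integral_const]
    simp only [probReal_univ, one_smul]
    field_simp
    ring
  have hℓs : ∫ ω, ∑ i, ℓ i ω ∂(e.law μ) ≤ n / 2 * Real.log (1 + P) := by
    rw [integral_finsetSum _ fun i _ => hℓ i]
    simp only [hℓv]
    rw [Finset.sum_add_distrib, ← Finset.sum_div, Finset.sum_sub_distrib]
    have := he.sum_le hP.le
    simp only [Finset.sum_const, Finset.card_univ, Fintype.card_fin, nsmul_eq_mul]
    have h2 : ((∑ i, ∫ ω, e.input i ω ^ 2 ∂(e.law μ)) - n * P) / (2 * (1 + P)) ≤ 0 :=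
      div_nonpos_of_nonpos_of_nonneg (by linarith) (by positivity)
    linarith
  have hsum : Integrable (fun ω => ∑ i, ℓ i ω) (e.law μ) := integrable_finsetSum _ fun i _ => hℓ i
  rw [← e.lintegral_mul_gaussianRatio μ hP (H := fun m y => ENNReal.ofReal (Real.exp (g m y)))
    (Real.measurable_exp.comp hg).ennreal_ofReal]
  calc _ ≤ ENNReal.ofReal (Real.exp (∫ ω, (g ω.1 (fun i => e.output i ω) - ∑ i, ℓ i ω)
        ∂(e.law μ))) := by
        rw [integral_sub hgi hsum]
        gcongr
    _ ≤ _ := ofReal_exp_integral_le_lintegral (hgi.sub hsum)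
    _ = _ := by
        refine lintegral_congr fun ω => ?_
        simp only [gaussianRatio]
        rw [← ENNReal.ofReal_prod_of_nonneg fun i _ => (Real.exp_pos _).le,
          ← ENNReal.ofReal_mul (Real.exp_pos _).le, ← Real.exp_sum, ← Real.exp_add, Finset.sum_neg_distrib, ← sub_eq_add_neg]
        simp only [ℓ, add_sub_assoc]

end Encoder

/-! ### Converse for the mean square error -/

instance : IsProbabilityMeasure unitLaw := by
  refine ⟨?_⟩
  rw [unitLaw, Measure.comap_apply _ Subtype.val_injective
    (fun s hs => measurableSet_Ioo.subtype_image hs) _ MeasurableSet.univ,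
    Set.image_univ, Subtype.range_coe, Real.volume_Ioo]
  simp

theorem lintegral_unitLaw (f : ℝ → ℝ≥0∞) :
    ∫⁻ m : UnitMsg, f m ∂unitLaw = ∫⁻ x in Set.Ioo (0 : ℝ) 1, f x :=
  lintegral_subtype_comap measurableSet_Ioo f

theorem lintegral_unitLaw_exp_le {s : ℝ} (hs : 0 < s) (c : ℝ) :
    ∫⁻ m : UnitMsg, ENNReal.ofReal (Real.exp (-s * ((m : ℝ) - c) ^ 2)) ∂unitLaw ≤
      ENNReal.ofReal √(Real.pi / s) := by
  rw [lintegral_unitLaw fun x => ENNReal.ofReal (Real.exp (-s * (x - c) ^ 2))]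
  refine (setLIntegral_le_lintegral _ _).trans ?_
  rw [lintegral_sub_right_eq_self (fun x => ENNReal.ofReal (Real.exp (-s * x ^ 2))) c,
    ← ofReal_integral_eq_lintegral_ofReal (integrable_exp_neg_mul_sq hs)
      (ae_of_all _ fun _ => (Real.exp_pos _).le), integral_gaussian]

section MeanSquareError

variable {n : ℕ} (e : Encoder UnitMsg n) (φ : Decoder UnitMsg n)

theorem integrable_sq_error : Integrable
    (fun ω : e.Sample => ((ω.1 : ℝ) - (φ.dec fun i => e.output i ω : ℝ)) ^ 2) (e.law unitLaw) := by
  refine Integrable.of_bound (C := 1) ?_ (ae_of_all _ fun ω => ?_)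
  · have h := φ.measurable_dec.comp e.measurable_outputs
    exact (((measurable_subtype_coe.comp measurable_fst).sub
      (measurable_subtype_coe.comp h)).pow_const 2).aestronglyMeasurable
  · have h1 := ω.1.2
    have h2 := (φ.dec fun i => e.output i ω).2
    rw [Set.mem_Ioo] at h1 h2
    rw [Real.norm_eq_abs, abs_of_nonneg (sq_nonneg _), sq_le_one_iff_abs_le_one, abs_le]
    constructor <;> linarith

theorem mse_nonneg : 0 ≤ mse e φ := integral_nonneg fun _ => sq_nonneg _

variable {P : ℝ}

/-- The variational bound with test function `-s (m - φ y)²`. Under the product law `φ y` is a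
constant for the message integral, which is dominated by a Gaussian integral over the whole line. -/
theorem exp_mse_le (hP : 0 < P) (he : e.MeetsPower unitLaw P) {s : ℝ} (hs : 0 < s) :
    Real.exp (-s * mse e φ - n / 2 * Real.log (1 + P)) ≤ √(Real.pi / s) := by
  have hg : Measurable (Function.uncurry fun (m : UnitMsg) (y : Fin n → ℝ) =>
      -s * ((m : ℝ) - φ.dec y) ^ 2) := by
    have := φ.measurable_dec
    unfold Function.uncurry
    fun_prop
  have h := e.ofReal_exp_integral_sub_le unitLaw hP he hg ((integrable_sq_error e φ).const_mul _)
  rw [integral_const_mul, lintegral_lintegral_swap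
    (Real.measurable_exp.comp hg).ennreal_ofReal.aemeasurable] at h
  refine (ENNReal.ofReal_le_ofReal_iff (Real.sqrt_nonneg _)).1 (h.trans ?_)
  calc _ ≤ ∫⁻ _y, ENNReal.ofReal √(Real.pi / s)
        ∂(Measure.pi fun _ : Fin n => gaussianReal 0 (1 + P).toNNReal) :=
        lintegral_mono fun y => lintegral_unitLaw_exp_le hs (φ.dec y)
    _ = _ := by rw [lintegral_const, measure_univ, mul_one]

/-- The mean square error of a feedback code cannot decay faster than `(1 + P)⁻ⁿ`. -/
theorem exp_le_mse (hP : 0 < P) (he : e.MeetsPower unitLaw P) :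
    Real.exp (-1 - n * Real.log (1 + P)) ≤ 2 * Real.pi * mse e φ := by
  have key : ∀ s : ℝ, 0 < s →
      Real.exp (-2 * s * mse e φ - n * Real.log (1 + P)) ≤ Real.pi / s := fun s hs => by
    have h := pow_le_pow_left₀ (Real.exp_pos _).le (exp_mse_le e φ hP he hs) 2
    rw [Real.sq_sqrt (by positivity), ← Real.exp_nat_mul] at h
    rwa [show -2 * s * mse e φ - n * Real.log (1 + P) =
      (2 : ℕ) * (-s * mse e φ - n / 2 * Real.log (1 + P)) by push_cast; ring]
  rcases (mse_nonneg e φ).eq_or_lt with h0 | hpos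
  -- If the error vanished, `key` would bound a fixed positive number by `π / s` for every `s`; this
  -- `s` already makes the bound half that number.
  · have h := key (2 * Real.pi * Real.exp (n * Real.log (1 + P))) (by positivity)
    rw [← h0, mul_zero, zero_sub, Real.exp_neg] at h
    have := Real.exp_pos (n * Real.log (1 + P))
    have := Real.pi_pos
    field_simp at h
    norm_num at h
  -- This choice of `s` turns the error term in the exponent into the constant `-1`.
  · have h := key (1 / (2 * mse e φ)) (by positivity)
    rw [show -2 * (1 / (2 * mse e φ)) * mse e φ = -1 by field_simp] at h
    exact h.trans_eq (by field_simp)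

theorem mse_pos (hP : 0 < P) (he : e.MeetsPower unitLaw P) : 0 < mse e φ := by
  have h := (Real.exp_pos _).trans_le (exp_le_mse e φ hP he)
  exact pos_of_mul_pos_right h (by positivity)

theorem mseExponent_le (hP : 0 < P) (he : e.MeetsPower unitLaw P) (hn : 0 < n) :
    mseExponent e φ ≤
      1 / 2 * Real.logb 2 (1 + P) + (1 + Real.log (2 * Real.pi)) / (2 * Real.log 2) / n := by
  have hD := mse_pos e φ hP he
  have h := Real.log_le_log (Real.exp_pos _) (exp_le_mse e φ hP he)
  rw [Real.log_exp, Real.log_mul (by positivity) hD.ne'] at h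
  have h2 : 0 < Real.log 2 := Real.log_pos one_lt_two
  have hn' : (0 : ℝ) < n := by exact_mod_cast hn
  rw [mseExponent, Real.logb, Real.logb]
  have : 1 / 2 * (Real.log (1 + P) / Real.log 2) +
      (1 + Real.log (2 * Real.pi)) / (2 * Real.log 2) / n -
      -(1 / (2 * n)) * (Real.log (mse e φ) / Real.log 2) =
      (Real.log (mse e φ) + Real.log (2 * Real.pi) + 1 + n * Real.log (1 + P)) /
        (2 * n * Real.log 2) := by
    field_simp
    ring
  have h3 : 0 ≤ (Real.log (mse e φ) + Real.log (2 * Real.pi) + 1 + n * Real.log (1 + P)) /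
        (2 * n * Real.log 2) := div_nonneg (by linarith) (by positivity)
  linarith

end MeanSquareError

theorem tendsto_add_div_atTop (c d : ℝ) :
    Tendsto (fun n : ℕ => c + d / n) atTop (nhds c) := by
  simpa using (tendsto_const_div_atTop_nhds_zero_nat d).const_add c

theorem mmseCapacity_le {P : ℝ} (hP : 0 < P) :
    mmseCapacity P ≤ ((1 / 2 * Real.logb 2 (1 + P) : ℝ) : EReal) := by
  refine sSup_le ?_
  rintro _ ⟨E, ⟨e, φ, he, hE⟩, rfl⟩
  have h1 : Tendsto (fun n : ℕ => ((1 / 2 * Real.logb 2 (1 + P) +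
      (1 + Real.log (2 * Real.pi)) / (2 * Real.log 2) / n : ℝ) : EReal)) atTop
      (nhds ((1 / 2 * Real.logb 2 (1 + P) : ℝ) : EReal)) :=
    (continuous_coe_real_ereal.tendsto _).comp (tendsto_add_div_atTop _ _)
  refine hE.trans (h1.liminf_eq ▸ liminf_le_liminf ?_)
  filter_upwards [eventually_gt_atTop 0] with n hn
  exact EReal.coe_le_coe_iff.2 (mseExponent_le (e n) (φ n) hP (he n) hn)

/-! ### Rates -/

theorem isProbabilityMeasure_uniformOn_fin {K : ℕ} (hK : 0 < K) :
    IsProbabilityMeasure (uniformOn (Set.univ : Set (Fin K))) :=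
  have : NeZero K := ⟨hK.ne'⟩
  isProbabilityMeasure_uniformOn Set.finite_univ Set.univ_nonempty

/-- A Fano inequality. The test function is `log K` on correct decoding and zero elsewhere. Under
the product law a guess is correct with probability `1 / K`, so the mean of `exp g` is at most `1 +
K * (1 / K) = 2`. -/
theorem one_sub_errorProb_mul_log_le {K n : ℕ} (hK : 0 < K) (e : Encoder (Fin K) n)
    (φ : Decoder (Fin K) n) {P : ℝ} (hP : 0 < P) (he : e.MeetsPower (uniformOn Set.univ) P) :
    (1 - (errorProb e φ).toReal) * Real.log K ≤ n / 2 * Real.log (1 + P) + Real.log 2 := by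
  have := isProbabilityMeasure_uniformOn_fin hK
  have hK' : (0 : ℝ) < K := by exact_mod_cast hK
  let g : Fin K → (Fin n → ℝ) → ℝ := fun m y => if m = φ.dec y then Real.log K else 0
  have hS : MeasurableSet {p : Fin K × (Fin n → ℝ) | p.1 = φ.dec p.2} :=
    measurableSet_eq_fun measurable_fst (φ.measurable_dec.comp measurable_snd)
  have hg : Measurable (Function.uncurry g) := Measurable.ite hS measurable_const measurable_const
  have hE : MeasurableSet {ω : e.Sample | ω.1 = φ.dec fun i => e.output i ω} :=
    hS.preimage (measurable_fst.prodMk e.measurable_outputs)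
  have hgE : (fun ω : e.Sample => g ω.1 fun i => e.output i ω) =
      {ω : e.Sample | ω.1 = φ.dec fun i => e.output i ω}.indicator fun _ => Real.log K := by
    funext ω
    simp only [g, Set.indicator, Set.mem_ofPred_eq]
  have h := e.ofReal_exp_integral_sub_le (uniformOn Set.univ) hP he hg
    (by rw [hgE]; exact (integrable_const _).indicator hE)
  have hint : ∫ ω, g ω.1 (fun i => e.output i ω) ∂(e.law (uniformOn Set.univ)) =
      (1 - (errorProb e φ).toReal) * Real.log K := by
    rw [hgE, integral_indicator_const _ hE, smul_eq_mul]
    congr 1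
    have hc : (errorProb e φ).toReal = (e.law (uniformOn Set.univ)).real
        {ω : e.Sample | ω.1 = φ.dec fun i => e.output i ω}ᶜ := rfl
    rw [hc, probReal_compl_eq_one_sub hE, sub_sub_cancel]
  rw [hint, lintegral_lintegral_swap
    (Real.measurable_exp.comp hg).ennreal_ofReal.aemeasurable] at h
  have hinner : ∀ y : Fin n → ℝ, ∫⁻ m, ENNReal.ofReal (Real.exp (g m y)) ∂(uniformOn Set.univ) ≤
      ENNReal.ofReal 2 := fun y => by
    calc _ ≤ ∫⁻ m, (1 + ({φ.dec y} : Set (Fin K)).indicator (fun _ => (K : ℝ≥0∞)) m)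
          ∂(uniformOn Set.univ) := by
          refine lintegral_mono fun m => ?_
          by_cases hm : m = φ.dec y
          · simp [g, hm, Real.exp_log hK']
          · simp [g, hm]
      _ = _ := by
          rw [lintegral_add_left measurable_const,
            lintegral_indicator_const (measurableSet_singleton _), lintegral_const, measure_univ,
            uniformOn_univ, Measure.count_singleton, Fintype.card_fin,
            ENNReal.mul_div_cancel (by simpa using hK.ne') (by simp), mul_one]
          norm_num
  have h2 := h.trans ((lintegral_mono hinner).trans_eq
    (by rw [lintegral_const, measure_univ, mul_one]))
  have h3 := Real.log_le_log (Real.exp_pos _) ((ENNReal.ofReal_le_ofReal_iff zero_le_two).1 h2)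
  rw [Real.log_exp] at h3
  linarith

theorem numMsg_pos (R : ℝ) (n : ℕ) : 0 < numMsg R n := Nat.ceil_pos.2 (by positivity)

theorem feedbackCapacity_le {P : ℝ} (hP : 0 < P) :
    feedbackCapacity P ≤ ((1 / 2 * Real.logb 2 (1 + P) : ℝ) : EReal) := by
  refine sSup_le ?_
  rintro _ ⟨R, ⟨e, φ, he, hR⟩, rfl⟩
  refine EReal.coe_le_coe_iff.2 ?_
  have hl2 : 0 < Real.log 2 := Real.log_pos one_lt_two
  have hε : Tendsto (fun n => (1 - (errorProb (e n) (φ n)).toReal) * R) atTop (nhds R) := by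
    have h1 := (ENNReal.tendsto_toReal ENNReal.zero_ne_top).comp hR
    simpa using (h1.const_sub 1).mul_const R
  refine le_of_tendsto_of_tendsto hε (tendsto_add_div_atTop _ 1) ?_
  filter_upwards [eventually_gt_atTop 0] with n hn
  have hn' : (0 : ℝ) < n := by exact_mod_cast hn
  have := isProbabilityMeasure_uniformOn_fin (numMsg_pos R n)
  have h := one_sub_errorProb_mul_log_le (numMsg_pos R n) (e n) (φ n) hP (he n)
  have hle : (errorProb (e n) (φ n)).toReal ≤ 1 := by
    unfold errorProb
    exact measureReal_le_one
  have hlog : n * R * Real.log 2 ≤ Real.log (numMsg R n) := by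
    rw [← Real.log_rpow two_pos]
    exact Real.log_le_log (by positivity) (Nat.le_ceil _)
  have h4 := (mul_le_mul_of_nonneg_left hlog (sub_nonneg.2 hle)).trans h
  have : 1 / 2 * Real.logb 2 (1 + P) + 1 / n - (1 - (errorProb (e n) (φ n)).toReal) * R =
      (n / 2 * Real.log (1 + P) + Real.log 2 -
        (1 - (errorProb (e n) (φ n)).toReal) * (n * R * Real.log 2)) / (n * Real.log 2) := by
    rw [Real.logb]
    field_simp
  have h5 := div_nonneg (sub_nonneg.2 h4) (mul_pos hn' hl2).le
  linarith

/-! ## Linear feedback encoders -/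

/-- The symbols of a scalar linear feedback encoder: `x` at first, and then
`Xᵢ₊₁ = s Xᵢ - t Yᵢ`. -/
def linearSymbol (s t x : ℝ) : (i : ℕ) → (Fin i → ℝ) → ℝ
  | 0, _ => x
  | i + 1, y => s * linearSymbol s t x i (fun k => y k.castSucc) - t * y (Fin.last i)

theorem measurable_linearSymbol (s t : ℝ) (i : ℕ) :
    Measurable fun q : ℝ × (Fin i → ℝ) => linearSymbol s t q.1 i q.2 := by
  induction i with
  | zero => exact measurable_fst
  | succ i ih =>
    have h1 : Measurable fun q : ℝ × (Fin (i + 1) → ℝ) => (q.1, fun k : Fin i => q.2 k.castSucc) := by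
      fun_prop
    have h2 : Measurable fun q : ℝ × (Fin (i + 1) → ℝ) => q.2 (Fin.last i) := by fun_prop
    exact ((ih.comp h1).const_mul s).sub (h2.const_mul t)

theorem linearSymbol_eq_add (s t x : ℝ) (i : ℕ) (y : Fin i → ℝ) :
    linearSymbol s t x i y = s ^ i * x + linearSymbol s t 0 i y := by
  induction i with
  | zero => simp [linearSymbol]
  | succ i ih =>
    rw [linearSymbol, linearSymbol, ih]
    ring

/-- The estimate of the first symbol from the outputs, undoing the recursion. -/
noncomputable def firstSymbolEstimate (s t : ℝ) (n : ℕ) (y : Fin n → ℝ) : ℝ :=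
  -(s ^ n)⁻¹ * linearSymbol s t 0 n y

theorem measurable_firstSymbolEstimate (s t : ℝ) (n : ℕ) :
    Measurable (firstSymbolEstimate s t n) :=
  ((measurable_linearSymbol s t n).comp (measurable_const.prodMk measurable_id)).const_mul _

/-- The estimation error is the symbol that would be sent next, scaled back by `sⁿ`; bounded power
therefore means geometrically small error. -/
theorem sub_firstSymbolEstimate {s : ℝ} (hs : s ≠ 0) (t x : ℝ) (n : ℕ) (y : Fin n → ℝ) :
    x - firstSymbolEstimate s t n y = (s ^ n)⁻¹ * linearSymbol s t x n y := by
  rw [linearSymbol_eq_add s t x, firstSymbolEstimate]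
  field_simp
  ring

namespace Encoder

variable {𝓜 : Type} [MeasurableSpace 𝓜] {n : ℕ}

/-- The encoder sends the symbols of the linear feedback scheme, the first one being `x m`. -/
def IsLinear (e : Encoder 𝓜 n) (s t : ℝ) (x : 𝓜 → ℝ) : Prop :=
  ∀ (i : Fin n) (m : 𝓜) (y : Fin i → ℝ) (v : e.Seed), e.enc i m y v = linearSymbol s t (x m) i y

/-- The symbol that the linear scheme sends after `i ≤ n` channel uses. -/
def linearInput (e : Encoder 𝓜 n) (s t : ℝ) (x : 𝓜 → ℝ) (i : ℕ) (hi : i ≤ n) (ω : e.Sample) : ℝ :=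
  linearSymbol s t (x ω.1) i fun k => e.output ⟨k, k.isLt.trans_le hi⟩ ω

theorem linearInput_succ (e : Encoder 𝓜 n) (s t : ℝ) (x : 𝓜 → ℝ) (i : ℕ) (hi : i < n)
    (ω : e.Sample) : e.linearInput s t x (i + 1) hi ω =
      s * e.linearInput s t x i hi.le ω - t * e.output ⟨i, hi⟩ ω := rfl

theorem IsLinear.input_eq {e : Encoder 𝓜 n} {s t : ℝ} {x : 𝓜 → ℝ} (h : e.IsLinear s t x)
    (i : Fin n) : e.input i = e.linearInput s t x i i.isLt.le := by
  funext ω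
  exact h i ω.1 _ _

/-- The power of the linear scheme approaches the stationary power geometrically. -/
theorem memLp_and_integral_linearInput_sq (e : Encoder 𝓜 n) {P : ℝ} (hP : 0 < P) {x : 𝓜 → ℝ}
    (μ : Measure 𝓜) [IsProbabilityMeasure μ] (hx : MemLp x 2 μ) (i : ℕ) (hi : i ≤ n)
    (h : ∀ (j : ℕ) (hj : j < i), e.input ⟨j, hj.trans_le hi⟩ =
      e.linearInput √(1 + P) (P / √(1 + P)) x j (hj.le.trans hi)) :
    MemLp (e.linearInput √(1 + P) (P / √(1 + P)) x i hi) 2 (e.law μ) ∧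
      ∫ ω, e.linearInput √(1 + P) (P / √(1 + P)) x i hi ω ^ 2 ∂(e.law μ) =
        P + ((∫ m, x m ^ 2 ∂μ) - P) / (1 + P) ^ i := by
  induction i with
  | zero =>
    have hf : MeasurePreserving (Prod.fst : e.Sample → 𝓜) (e.law μ) μ := measurePreserving_fst
    refine ⟨hx.comp_measurePreserving hf, ?_⟩
    rw [pow_zero, div_one, add_sub_cancel]
    conv_rhs => rw [← hf.map_eq]
    rw [integral_map hf.measurable.aemeasurable]
    · rfl
    · rw [hf.map_eq]
      exact hx.aestronglyMeasurable.pow 2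
  | succ i ih =>
    obtain ⟨h1, h2⟩ := ih (Nat.le_of_succ_le hi) fun j hj => h j (hj.trans i.lt_succ_self)
    have hin : e.linearInput √(1 + P) (P / √(1 + P)) x i (Nat.le_of_succ_le hi) =
      e.input ⟨i, hi⟩ := (h i i.lt_succ_self).symm
    have hsq : √(1 + P) ^ 2 = 1 + P := Real.sq_sqrt (by linarith)
    have hs0 : √(1 + P) ≠ 0 := (Real.sqrt_pos.2 (by linarith)).ne'
    -- This identity makes the input power contract by the factor `1 / (1 + P)` at each step.
    have hst : √(1 + P) - P / √(1 + P) = 1 / √(1 + P) := by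
      field_simp
      linarith
    have hsucc : e.linearInput √(1 + P) (P / √(1 + P)) x (i + 1) hi = fun ω =>
        √(1 + P) * e.input ⟨i, hi⟩ ω - P / √(1 + P) * e.output ⟨i, hi⟩ ω := by
      funext ω
      rw [linearInput_succ, hin]
    rw [hin] at h1 h2
    rw [hsucc]
    refine ⟨e.memLp_sub_output μ h1 _ _, ?_⟩
    rw [e.integral_sub_output_sq μ h1, h2, hst, div_pow, div_pow, hsq]
    have : 1 + P ≠ 0 := by linarith
    field_simp
    ring

theorem IsLinear.memLp_and_integral_sq {e : Encoder 𝓜 n} {P : ℝ} (hP : 0 < P) {x : 𝓜 → ℝ}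
    (h : e.IsLinear √(1 + P) (P / √(1 + P)) x) (μ : Measure 𝓜) [IsProbabilityMeasure μ]
    (hx : MemLp x 2 μ) (i : ℕ) (hi : i ≤ n) :
    MemLp (e.linearInput √(1 + P) (P / √(1 + P)) x i hi) 2 (e.law μ) ∧
      ∫ ω, e.linearInput √(1 + P) (P / √(1 + P)) x i hi ω ^ 2 ∂(e.law μ) =
        P + ((∫ m, x m ^ 2 ∂μ) - P) / (1 + P) ^ i :=
  e.memLp_and_integral_linearInput_sq hP μ hx i hi fun j hj => h.input_eq ⟨j, hj.trans_le hi⟩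

theorem IsLinear.memLp_input {e : Encoder 𝓜 n} {P : ℝ} (hP : 0 < P) {x : 𝓜 → ℝ}
    (h : e.IsLinear √(1 + P) (P / √(1 + P)) x) (μ : Measure 𝓜) [IsProbabilityMeasure μ]
    (hx : MemLp x 2 μ) (i : Fin n) : MemLp (e.input i) 2 (e.law μ) := by
  rw [h.input_eq i]
  exact (h.memLp_and_integral_sq hP μ hx i _).1

theorem IsLinear.inputPower_eq {e : Encoder 𝓜 n} {P : ℝ} (hP : 0 < P) {x : 𝓜 → ℝ}
    (h : e.IsLinear √(1 + P) (P / √(1 + P)) x) (μ : Measure 𝓜) [IsProbabilityMeasure μ]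
    (hx : MemLp x 2 μ) (i : Fin n) : e.inputPower μ i =
      ENNReal.ofReal (P + ((∫ m, x m ^ 2 ∂μ) - P) / (1 + P) ^ (i : ℕ)) := by
  rw [e.inputPower_eq_ofReal μ (h.memLp_input hP μ hx i), h.input_eq i,
    (h.memLp_and_integral_sq hP μ hx i _).2]

theorem IsLinear.meetsPower {e : Encoder 𝓜 n} {P : ℝ} (hP : 0 < P) {x : 𝓜 → ℝ}
    (h : e.IsLinear √(1 + P) (P / √(1 + P)) x) (μ : Measure 𝓜) [IsProbabilityMeasure μ]
    (hx : MemLp x 2 μ) (hxP : ∫ m, x m ^ 2 ∂μ ≤ P) : e.MeetsPower μ P := by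
  refine e.meetsPower_of_forall_le μ fun i => ?_
  rw [h.inputPower_eq hP μ hx i]
  refine ENNReal.ofReal_le_ofReal ?_
  have : ((∫ m, x m ^ 2 ∂μ) - P) / (1 + P) ^ (i : ℕ) ≤ 0 :=
    div_nonpos_of_nonpos_of_nonneg (by linarith) (by positivity)
  linarith

/-- The error of the estimate of the first symbol decays like `(1 + P)⁻ⁿ`. -/
theorem IsLinear.integral_sub_estimate_sq_le {e : Encoder 𝓜 n} {P : ℝ} (hP : 0 < P) {x : 𝓜 → ℝ}
    (h : e.IsLinear √(1 + P) (P / √(1 + P)) x) (μ : Measure 𝓜) [IsProbabilityMeasure μ]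
    (hx : MemLp x 2 μ) (hxP : ∫ m, x m ^ 2 ∂μ ≤ P) :
    Integrable (fun ω => (x ω.1 - firstSymbolEstimate √(1 + P) (P / √(1 + P)) n
      fun i => e.output i ω) ^ 2) (e.law μ) ∧
    ∫ ω, (x ω.1 - firstSymbolEstimate √(1 + P) (P / √(1 + P)) n
      fun i => e.output i ω) ^ 2 ∂(e.law μ) ≤ P / (1 + P) ^ n := by
  obtain ⟨h1, h2⟩ := h.memLp_and_integral_sq hP μ hx n le_rfl
  have hs0 : √(1 + P) ≠ 0 := (Real.sqrt_pos.2 (by linarith)).ne'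
  have hsq : √(1 + P) ^ 2 = 1 + P := Real.sq_sqrt (by linarith)
  have heq : ∀ ω : e.Sample, (x ω.1 - firstSymbolEstimate √(1 + P) (P / √(1 + P)) n
      fun i => e.output i ω) ^ 2 =
      ((1 + P) ^ n)⁻¹ * e.linearInput √(1 + P) (P / √(1 + P)) x n le_rfl ω ^ 2 := fun ω => by
    rw [sub_firstSymbolEstimate hs0, mul_pow, inv_pow, ← pow_mul, mul_comm n 2, pow_mul, hsq]
    rfl
  simp_rw [heq]
  refine ⟨h1.integrable_sq.const_mul _, ?_⟩
  rw [integral_const_mul, h2, div_eq_inv_mul P]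
  refine mul_le_mul_of_nonneg_left ?_ (by positivity)
  have : ((∫ m, x m ^ 2 ∂μ) - P) / (1 + P) ^ n ≤ 0 :=
    div_nonpos_of_nonpos_of_nonneg (by linarith) (by positivity)
  linarith

end Encoder

/-- The linear feedback encoder with first symbol `x m`. -/
noncomputable def linearEncoder {𝓜 : Type} [MeasurableSpace 𝓜] (s t : ℝ) {x : 𝓜 → ℝ} (hx : Measurable x)
    (n : ℕ) : Encoder 𝓜 n where
  Seed := Unit
  seedSpace := inferInstance
  seedLaw := Measure.dirac fun _ => ()
  seedLaw_prob := inferInstance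
  enc i m y _ := linearSymbol s t (x m) i y
  measurable_enc i :=
    (measurable_linearSymbol s t i).comp ((hx.comp measurable_fst).prodMk
      (measurable_fst.comp measurable_snd))

theorem linearEncoder_isLinear {𝓜 : Type} [MeasurableSpace 𝓜] (s t : ℝ) {x : 𝓜 → ℝ}
    (hx : Measurable x) (n : ℕ) : (linearEncoder s t hx n).IsLinear s t x :=
  fun _ _ _ _ => rfl

/-! ## Achievability -/

theorem abs_sub_clamp_le {m u δ : ℝ} (hm0 : 0 < m) (hm1 : m < 1) (hδ : 0 ≤ δ) (hδ2 : δ ≤ 1 / 2) :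
    |m - max δ (min u (1 - δ))| ≤ |m - u| + δ := by
  have h1 := le_abs_self (m - u)
  have h2 := neg_abs_le (m - u)
  have h3 := abs_nonneg (m - u)
  rw [abs_le]
  rcases le_total u (1 - δ) with hu | hu
  · rw [min_eq_left hu]
    rcases le_total δ u with h | h
    · rw [max_eq_right h]; constructor <;> linarith
    · rw [max_eq_left h]; constructor <;> linarith
  · rw [min_eq_right hu, max_eq_right (by linarith)]
    constructor <;> linarith

theorem memLp_affine_unitLaw (a b : ℝ) : MemLp (fun m : UnitMsg => a * (m : ℝ) + b) 2 unitLaw := by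
  refine MemLp.of_bound (Measurable.aestronglyMeasurable (by fun_prop)) (|a| + |b|)
    (ae_of_all _ fun m => ?_)
  refine (norm_add_le _ _).trans ?_
  rw [norm_mul, Real.norm_eq_abs, Real.norm_eq_abs, Real.norm_eq_abs, abs_of_pos m.2.1]
  have := mul_le_mul_of_nonneg_left m.2.2.le (abs_nonneg a)
  linarith

/-- The decoder inverts the affine map on the estimate of the first symbol. It must return a point
of the open interval, so the result is clamped to `[δ, 1 - δ]`. -/
theorem exists_decoder_mse_le {n : ℕ} {e : Encoder UnitMsg n} {P a b : ℝ} (hP : 0 < P)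
    (ha : a ≠ 0) (h : e.IsLinear √(1 + P) (P / √(1 + P)) fun m => a * (m : ℝ) + b)
    (hab : ∫ m : UnitMsg, (a * (m : ℝ) + b) ^ 2 ∂unitLaw = P) :
    ∃ φ : Decoder UnitMsg n, mse e φ ≤ (2 * P / a ^ 2 + 1) / (1 + P) ^ n := by
  set s := √(1 + P)
  have hsq : s ^ 2 = 1 + P := Real.sq_sqrt (by linarith)
  have hs1 : 1 ≤ s := Real.one_le_sqrt.2 (by linarith)
  -- With `δ` of order `(1 + P)^(-n/2)`, the clamping loss `δ²` has the same order as the estimation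
  -- error.
  set δ := (s ^ n)⁻¹ / 2
  have hδ0 : 0 < δ := by positivity
  have hδ1 : δ ≤ 1 / 2 := by
    have := inv_le_one_of_one_le₀ (one_le_pow₀ hs1 : 1 ≤ s ^ n)
    simp only [δ]; linarith
  have hδsq : 2 * δ ^ 2 ≤ 1 / (1 + P) ^ n := by
    have : δ ^ 2 = ((1 + P) ^ n)⁻¹ / 4 := by
      rw [div_pow, inv_pow, ← pow_mul, mul_comm n 2, pow_mul, hsq]
      norm_num
    have h0 : 0 < ((1 + P) ^ n)⁻¹ := by positivity
    rw [this, one_div]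
    linarith
  let u : (Fin n → ℝ) → ℝ := fun y => (firstSymbolEstimate s (P / s) n y - b) / a
  have hu : Measurable u := ((measurable_firstSymbolEstimate _ _ _).sub_const b).div_const a
  have hmem : ∀ x, max δ (min x (1 - δ)) ∈ Set.Ioo (0 : ℝ) 1 := fun x =>
    ⟨hδ0.trans_le (le_max_left _ _),
      max_lt (by linarith) ((min_le_right _ _).trans_lt (by linarith))⟩
  let φ : Decoder UnitMsg n := ⟨fun y => ⟨max δ (min (u y) (1 - δ)), hmem _⟩,
    (measurable_const.max (hu.min measurable_const)).subtype_mk⟩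
  refine ⟨φ, ?_⟩
  obtain ⟨hi, hle⟩ := h.integral_sub_estimate_sq_le hP unitLaw (memLp_affine_unitLaw a b) hab.le
  have hpt : ∀ ω : e.Sample, ((ω.1 : ℝ) - (φ.dec fun i => e.output i ω : ℝ)) ^ 2 ≤
      2 / a ^ 2 * (a * (ω.1 : ℝ) + b - firstSymbolEstimate s (P / s) n
        fun i => e.output i ω) ^ 2 + 2 * δ ^ 2 := fun ω => by
    have h1 := abs_sub_clamp_le (u := u fun i => e.output i ω) ω.1.2.1 ω.1.2.2 hδ0.le hδ1
    have h2 : (ω.1 : ℝ) - u (fun i => e.output i ω) =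
        (a * (ω.1 : ℝ) + b - firstSymbolEstimate s (P / s) n fun i => e.output i ω) / a := by
      simp only [u]
      field_simp
      ring
    have h3 := pow_le_pow_left₀ (abs_nonneg _) h1 2
    have h4 := add_sq_le (a := |(ω.1 : ℝ) - u fun i => e.output i ω|) (b := δ)
    rw [sq_abs] at h3 h4
    refine (h3.trans h4).trans_eq ?_
    rw [h2]
    field_simp
  calc mse e φ ≤ ∫ ω, (2 / a ^ 2 * (a * (ω.1 : ℝ) + b - firstSymbolEstimate s (P / s) n
        fun i => e.output i ω) ^ 2 + 2 * δ ^ 2) ∂(e.law unitLaw) :=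
        integral_mono (integrable_sq_error e φ)
          ((hi.const_mul _).add (integrable_const _)) hpt
    _ = 2 / a ^ 2 * (∫ ω, (a * (ω.1 : ℝ) + b - firstSymbolEstimate s (P / s) n
        fun i => e.output i ω) ^ 2 ∂(e.law unitLaw)) + 2 * δ ^ 2 := by
        rw [integral_add (hi.const_mul _) (integrable_const _), integral_const_mul,
          integral_const, probReal_univ, one_smul]
    _ ≤ 2 / a ^ 2 * (P / (1 + P) ^ n) + 1 / (1 + P) ^ n := by gcongr
    _ = _ := by field_simp

/-- Linear encoders with affine first symbol of power `P` have MSE exponent `½ log₂(1 + P)`. -/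
theorem exists_decoders_le_liminf {P a b : ℝ} (hP : 0 < P) (ha : a ≠ 0)
    (e : ∀ n, Encoder UnitMsg n)
    (h : ∀ n, (e n).IsLinear √(1 + P) (P / √(1 + P)) fun m => a * (m : ℝ) + b)
    (hab : ∫ m : UnitMsg, (a * (m : ℝ) + b) ^ 2 ∂unitLaw = P) :
    ∃ φ : ∀ n, Decoder UnitMsg n, ((1 / 2 * Real.logb 2 (1 + P) : ℝ) : EReal) ≤
      liminf (fun n => (mseExponent (e n) (φ n) : EReal)) atTop := by
  choose φ hφ using fun n => exists_decoder_mse_le hP ha (h n) hab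
  refine ⟨φ, ?_⟩
  have h1 : Tendsto (fun n : ℕ => ((1 / 2 * Real.logb 2 (1 + P) +
      -(Real.logb 2 (2 * P / a ^ 2 + 1) / 2) / n : ℝ) : EReal)) atTop
      (nhds ((1 / 2 * Real.logb 2 (1 + P) : ℝ) : EReal)) :=
    (continuous_coe_real_ereal.tendsto _).comp (tendsto_add_div_atTop _ _)
  rw [← h1.liminf_eq]
  refine liminf_le_liminf ?_
  filter_upwards [eventually_gt_atTop 0] with n hn
  refine EReal.coe_le_coe_iff.2 ?_
  have hn' : (0 : ℝ) < n := by exact_mod_cast hn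
  have hpos := mse_pos (e n) (φ n) hP ((h n).meetsPower hP unitLaw (memLp_affine_unitLaw a b) hab.le)
  have hlog := Real.logb_le_logb_of_le one_lt_two hpos (hφ n)
  have hG : 0 < 2 * P / a ^ 2 + 1 := by positivity
  rw [Real.logb_div hG.ne' (by positivity), Real.logb_pow] at hlog
  rw [mseExponent]
  have := mul_le_mul_of_nonneg_left hlog (by positivity : 0 ≤ 1 / (2 * (n : ℝ)))
  calc _ = -(1 / (2 * (n : ℝ)) *
        (Real.logb 2 (2 * P / a ^ 2 + 1) - n * Real.logb 2 (1 + P))) := by field_simp; ring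
    _ ≤ -(1 / (2 * (n : ℝ)) * Real.logb 2 (mse (e n) (φ n))) := neg_le_neg this
    _ = _ := by ring

/-! ### Values of the two capacities -/

theorem integral_unitLaw_sq : ∫ m : UnitMsg, (m : ℝ) ^ 2 ∂unitLaw = 1 / 3 := by
  have h : ∫ m : UnitMsg, (m : ℝ) ^ 2 ∂unitLaw = ∫ x in Set.Ioo (0 : ℝ) 1, x ^ 2 :=
    integral_subtype_comap measurableSet_Ioo fun x => x ^ 2
  rw [h, ← integral_Ioc_eq_integral_Ioo, ← intervalIntegral.integral_of_le zero_le_one,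
    integral_pow]
  norm_num

theorem integral_unitLaw_sqrt_mul_sq {P : ℝ} (hP : 0 < P) :
    ∫ m : UnitMsg, (√(3 * P) * (m : ℝ) + 0) ^ 2 ∂unitLaw = P := by
  simp only [add_zero, mul_pow]
  rw [integral_const_mul, integral_unitLaw_sq, Real.sq_sqrt (by positivity)]
  ring

theorem mmseCapacity_eq {P : ℝ} (hP : 0 < P) :
    mmseCapacity P = ((1 / 2 * Real.logb 2 (1 + P) : ℝ) : EReal) := by
  refine le_antisymm (mmseCapacity_le hP) (le_sSup ⟨_, ?_, rfl⟩)
  have hx : Measurable fun m : UnitMsg => √(3 * P) * (m : ℝ) + 0 := by fun_prop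
  have hlin := linearEncoder_isLinear √(1 + P) (P / √(1 + P)) hx
  obtain ⟨φ, hφ⟩ := exists_decoders_le_liminf hP (Real.sqrt_ne_zero'.2 (by positivity)) _ hlin
    (integral_unitLaw_sqrt_mul_sq hP)
  exact ⟨_, φ, fun n => (hlin n).meetsPower hP unitLaw (memLp_affine_unitLaw _ _)
    (integral_unitLaw_sqrt_mul_sq hP).le, hφ⟩

/-- Rounding decoder for the messages `0, …, K - 1`. -/
noncomputable def roundingDecoder {K n : ℕ} (hK : 0 < K) {u : (Fin n → ℝ) → ℝ} (hu : Measurable u) :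
    Decoder (Fin K) n where
  dec y := if h : ⌊u y + 1 / 2⌋₊ < K then ⟨⌊u y + 1 / 2⌋₊, h⟩ else ⟨0, hK⟩
  measurable_dec :=
    (measurable_from_nat (f := fun k => if h : k < K then (⟨k, h⟩ : Fin K) else ⟨0, hK⟩)).comp
      (Nat.measurable_floor.comp (hu.add_const _))

theorem roundingDecoder_dec_eq {K n : ℕ} (hK : 0 < K) {u : (Fin n → ℝ) → ℝ} (hu : Measurable u)
    (m : Fin K) (y : Fin n → ℝ) (h : ((m : ℝ) - u y) ^ 2 < 1 / 4) :
    (roundingDecoder hK hu).dec y = m := by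
  obtain ⟨h1, h2⟩ := abs_lt_of_sq_lt_sq' (show ((m : ℝ) - u y) ^ 2 < (1 / 2) ^ 2 by linarith)
    (by norm_num)
  have hfl : ⌊u y + 1 / 2⌋₊ = m := by
    have hm : (0 : ℝ) ≤ (m : ℕ) := Nat.cast_nonneg _
    rw [Nat.floor_eq_iff (by linarith)]
    constructor <;> linarith
  simp only [roundingDecoder, hfl, m.isLt, dif_pos]

/-- The messages become points of `[0, √P]` with spacing `√P / K`. Rounding fails only if the
squared error of the estimate is at least `P / (4 K²)`, and Markov's inequality bounds the
probability of that. -/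
theorem exists_code_errorProb_le {P : ℝ} (hP : 0 < P) {K : ℕ} (hK : 0 < K) (n : ℕ) :
    ∃ (e : Encoder (Fin K) n) (φ : Decoder (Fin K) n), e.MeetsPower (uniformOn Set.univ) P ∧
      errorProb e φ ≤ ENNReal.ofReal (4 * K ^ 2 / (1 + P) ^ n) := by
  have := isProbabilityMeasure_uniformOn_fin hK
  have hK' : (0 : ℝ) < K := by exact_mod_cast hK
  have hsP : 0 < √P := Real.sqrt_pos.2 hP
  let x : Fin K → ℝ := fun m => √P / K * m
  have hx : Measurable x := measurable_of_finite x
  have hxb : ∀ m, ‖x m‖ ≤ √P := fun m => by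
    rw [Real.norm_eq_abs, abs_of_nonneg (by positivity)]
    simp only [x]
    rw [div_mul_eq_mul_div, div_le_iff₀ hK']
    gcongr
    exact_mod_cast m.isLt.le
  have hxL : MemLp x 2 (uniformOn Set.univ) :=
    MemLp.of_bound hx.aestronglyMeasurable _ (ae_of_all _ hxb)
  have hxP : ∫ m, x m ^ 2 ∂(uniformOn Set.univ) ≤ P := by
    calc _ ≤ ∫ _m, P ∂(uniformOn (Set.univ : Set (Fin K))) := by
          refine integral_mono hxL.integrable_sq (integrable_const _) fun m => ?_
          have := pow_le_pow_left₀ (norm_nonneg _) (hxb m) 2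
          rwa [Real.norm_eq_abs, sq_abs, Real.sq_sqrt hP.le] at this
      _ = P := by simp
  have hlin := linearEncoder_isLinear √(1 + P) (P / √(1 + P)) hx n
  set e := linearEncoder √(1 + P) (P / √(1 + P)) hx n
  have hu : Measurable fun y => K / √P * firstSymbolEstimate √(1 + P) (P / √(1 + P)) n y :=
    (measurable_firstSymbolEstimate _ _ _).const_mul _
  refine ⟨e, roundingDecoder hK hu, hlin.meetsPower hP _ hxL hxP, ?_⟩
  obtain ⟨hi, hle⟩ := hlin.integral_sub_estimate_sq_le hP _ hxL hxP
  let D : e.Sample → ℝ := fun ω => (x ω.1 - firstSymbolEstimate √(1 + P) (P / √(1 + P)) n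
    fun i => e.output i ω) ^ 2
  have hsub : {ω : e.Sample | ω.1 ≠ (roundingDecoder hK hu).dec fun i => e.output i ω} ⊆
      {ω | P / (4 * K ^ 2) ≤ D ω} := fun ω hω => by
    by_contra hlt
    refine hω (roundingDecoder_dec_eq hK hu ω.1 _ ?_).symm
    have hlt' : D ω < P / (4 * K ^ 2) := not_le.1 hlt
    have heq : ((ω.1 : ℕ) - K / √P * firstSymbolEstimate √(1 + P) (P / √(1 + P)) n
        fun i => e.output i ω : ℝ) ^ 2 = K ^ 2 / P * D ω := by
      have hPP : P = √P ^ 2 := (Real.sq_sqrt hP.le).symm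
      simp only [D, x]
      rw [show (K : ℝ) ^ 2 / P = (K / √P) ^ 2 by rw [div_pow, ← hPP], ← mul_pow]
      congr 1
      field_simp
    rw [heq]
    calc (K : ℝ) ^ 2 / P * D ω < K ^ 2 / P * (P / (4 * K ^ 2)) := by gcongr
      _ = 1 / 4 := by field_simp
  have hmk := mul_meas_ge_le_integral_of_nonneg (ae_of_all _ fun ω => sq_nonneg _) hi
    (P / (4 * K ^ 2))
  have hreal : (e.law (uniformOn Set.univ)).real {ω | P / (4 * K ^ 2) ≤ D ω} ≤
      4 * K ^ 2 / (1 + P) ^ n := by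
    have h3 := hmk.trans hle
    rw [← le_div_iff₀' (by positivity)] at h3
    refine h3.trans_eq ?_
    field_simp
  unfold errorProb
  refine (measure_mono hsub).trans ?_
  rw [← ofReal_measureReal]
  exact ENNReal.ofReal_le_ofReal hreal

/-- The squared number of messages is at most `4 * 2^(2nR)`, so the error bound is geometric with
ratio `2^(2R) / (1 + P)`, which is below one exactly under the rate condition. -/
theorem achievableRate_of_lt {P R : ℝ} (hP : 0 < P) (hR0 : 0 ≤ R)
    (hR : R < 1 / 2 * Real.logb 2 (1 + P)) : AchievableRate P R := by
  choose e φ he hφ using fun n => exists_code_errorProb_le hP (numMsg_pos R n) n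
  refine ⟨e, φ, he, ?_⟩
  have hq1 : (2 : ℝ) ^ (2 * R) / (1 + P) < 1 := by
    rw [div_lt_one (by linarith)]
    calc (2 : ℝ) ^ (2 * R) < 2 ^ Real.logb 2 (1 + P) :=
          Real.rpow_lt_rpow_of_exponent_lt one_lt_two (by linarith)
      _ = 1 + P := Real.rpow_logb two_pos (by norm_num) (by linarith)
  have hlim : Tendsto (fun n : ℕ => ENNReal.ofReal (16 * ((2 : ℝ) ^ (2 * R) / (1 + P)) ^ n)) atTop
      (nhds 0) := by
    have h1 := (tendsto_pow_atTop_nhds_zero_of_lt_one (by positivity) hq1).const_mul (16 : ℝ)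
    rw [mul_zero] at h1
    simpa using ENNReal.tendsto_ofReal h1
  refine tendsto_of_tendsto_of_tendsto_of_le_of_le tendsto_const_nhds hlim (fun _ => zero_le)
    fun n => (hφ n).trans (ENNReal.ofReal_le_ofReal ?_)
  have h1 : (1 : ℝ) ≤ 2 ^ (n * R) := Real.one_le_rpow one_le_two (by positivity)
  have hK : (numMsg R n : ℝ) ≤ 2 * 2 ^ (n * R) := by
    have := (Nat.ceil_lt_add_one (by positivity : (0 : ℝ) ≤ 2 ^ (n * R))).le
    unfold numMsg
    linarith
  have h2 : ((2 : ℝ) ^ (n * R)) ^ 2 = ((2 : ℝ) ^ (2 * R)) ^ n := by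
    rw [← Real.rpow_mul_natCast zero_le_two, ← Real.rpow_mul_natCast zero_le_two]
    congr 1
    push_cast
    ring
  calc 4 * (numMsg R n : ℝ) ^ 2 / (1 + P) ^ n ≤ 4 * (2 * 2 ^ (n * R)) ^ 2 / (1 + P) ^ n := by gcongr
    _ = 16 * ((2 : ℝ) ^ (2 * R) / (1 + P)) ^ n := by
      rw [mul_pow, h2, div_pow]
      ring

theorem feedbackCapacity_eq {P : ℝ} (hP : 0 < P) :
    feedbackCapacity P = ((1 / 2 * Real.logb 2 (1 + P) : ℝ) : EReal) := by
  refine le_antisymm (feedbackCapacity_le hP) ?_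
  have hC : 0 < 1 / 2 * Real.logb 2 (1 + P) :=
    mul_pos one_half_pos (Real.logb_pos one_lt_two (by linarith))
  refine le_of_forall_lt fun c hc => ?_
  -- The maximum with zero keeps the chosen rate nonnegative, as the rounding of `2^(nr)` requires.
  obtain ⟨r, hcr, hr⟩ := EReal.lt_iff_exists_real_btwn.1
    (max_lt hc (EReal.coe_lt_coe_iff.2 hC))
  have hr0 : 0 < r := EReal.coe_lt_coe_iff.1 ((le_max_right _ _).trans_lt hcr)
  exact ((le_max_left _ _).trans_lt hcr).trans_le
    (le_sSup ⟨r, achievableRate_of_lt hP hr0.le (EReal.coe_lt_coe_iff.1 hr), rfl⟩)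

/-! ## The filter -/

section Filter

open Polynomial

/-- A nonzero constant over a monic linear polynomial is already in lowest terms. -/
theorem ratFunc_num_denom_C_div_X_sub_C {κ : ℝ} (hκ : κ ≠ 0) (β : ℝ) :
    (RatFunc.C κ / (RatFunc.X - RatFunc.C β)).num = C κ ∧
      (RatFunc.C κ / (RatFunc.X - RatFunc.C β)).denom = X - C β := by
  set F : RatFunc ℝ := RatFunc.C κ / (RatFunc.X - RatFunc.C β) with hF
  have hX : (X - C β : ℝ[X]) ≠ 0 := X_sub_C_ne_zero β
  have hFe : F = algebraMap ℝ[X] (RatFunc ℝ) (C κ) / algebraMap ℝ[X] (RatFunc ℝ) (X - C β) := by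
    simp [hF]
  have h := (RatFunc.num_mul_eq_mul_denom_iff hX).2 hFe
  have hd : F.denom = X - C β := by
    refine eq_of_monic_of_associated F.monic_denom (monic_X_sub_C β)
      (associated_of_dvd_dvd ?_ ?_)
    · rw [hFe]; exact RatFunc.denom_div_dvd _ _
    · have h1 : X - C β ∣ C κ * F.denom := ⟨F.num, by rw [← h, mul_comm]⟩
      exact ((isUnit_C.2 hκ.isUnit).dvd_mul_left).1 h1
  refine ⟨?_, hd⟩
  rw [hd] at h
  exact mul_right_cancel₀ hX h

theorem ratFunc_X_sub_C_ne_zero (a : ℝ) : (RatFunc.X - RatFunc.C a : RatFunc ℝ) ≠ 0 := by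
  rw [← RatFunc.algebraMap_X, ← RatFunc.algebraMap_C, ← map_sub]
  exact RatFunc.algebraMap_ne_zero (X_sub_C_ne_zero a)

theorem C_div_X_sub_C_eq_iff {u a v b : ℝ} (hv : v ≠ 0) :
    (RatFunc.C u / (RatFunc.X - RatFunc.C a) : RatFunc ℝ) =
      RatFunc.C v / (RatFunc.X - RatFunc.C b) ↔ u = v ∧ a = b := by
  constructor
  · intro h
    have hu : u ≠ 0 := by
      rintro rfl
      rw [map_zero, zero_div, eq_comm, div_eq_zero_iff] at h
      rcases h with h | h
      · exact hv (by simpa using h)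
      · exact ratFunc_X_sub_C_ne_zero b h
    obtain ⟨h1, h2⟩ := ratFunc_num_denom_C_div_X_sub_C hu a
    obtain ⟨h3, h4⟩ := ratFunc_num_denom_C_div_X_sub_C hv b
    rw [h] at h1 h2
    refine ⟨C_injective (h1.symm.trans h3), C_injective ?_⟩
    exact sub_right_injective (h2.symm.trans h4)
  · rintro ⟨rfl, rfl⟩
    rfl

theorem awgnFilter_eq (β : ℝ) :
    awgnFilter β = RatFunc.C (-((β ^ 2 - 1) / β)) / (RatFunc.X - RatFunc.C β) := by
  have h1 := ratFunc_X_sub_C_ne_zero β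
  have hX : (RatFunc.X : RatFunc ℝ) ≠ 0 := RatFunc.X_ne_zero
  have h2 : (1 - RatFunc.C β * RatFunc.X⁻¹ : RatFunc ℝ) = (RatFunc.X - RatFunc.C β) / RatFunc.X := by
    field_simp
  rw [awgnFilter, h2, div_eq_mul_inv (β ^ 2 - 1) β, map_neg, map_mul (RatFunc.C (K := ℝ))]
  field_simp

variable {β : ℝ}

theorem awgnFilter_gain_ne_zero (hβ : 1 < β) : -((β ^ 2 - 1) / β) ≠ 0 := by
  have : 0 < β ^ 2 - 1 := by nlinarith
  exact neg_ne_zero.2 (by positivity)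

theorem awgnFilter_num (hβ : 1 < β) : (awgnFilter β).num = C (-((β ^ 2 - 1) / β)) := by
  rw [awgnFilter_eq]
  exact (ratFunc_num_denom_C_div_X_sub_C (awgnFilter_gain_ne_zero hβ) β).1

theorem awgnFilter_denom (hβ : 1 < β) : (awgnFilter β).denom = X - C β := by
  rw [awgnFilter_eq]
  exact (ratFunc_num_denom_C_div_X_sub_C (awgnFilter_gain_ne_zero hβ) β).2

theorem isStrictlyCausal_awgnFilter (hβ : 1 < β) : IsStrictlyCausal (awgnFilter β) := by
  rw [IsStrictlyCausal, awgnFilter_num hβ, awgnFilter_denom hβ, degree_X_sub_C]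
  exact degree_C_le.trans_lt zero_lt_one

theorem poles_awgnFilter (hβ : 1 < β) : poles (awgnFilter β) = {(β : ℂ)} := by
  rw [poles, awgnFilter_denom hβ, Polynomial.map_sub, map_X, map_C, roots_X_sub_C]
  rfl

theorem instability_awgnFilter (hβ : 1 < β) : instability (awgnFilter β) = Real.logb 2 β := by
  have h : ‖(β : ℂ)‖ = β := by rw [Complex.norm_real, Real.norm_of_nonneg (by linarith)]
  rw [instability, poles_awgnFilter hβ, Multiset.filter_singleton, if_pos (by rwa [h])]
  simp

theorem freqResponse_awgnFilter (hβ : 1 < β) (ω : ℝ) : freqResponse (awgnFilter β) ω =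
    -(((β : ℂ) ^ 2 - 1) / β) / (Complex.exp (ω * Complex.I) - β) := by
  rw [freqResponse, RatFunc.eval, awgnFilter_num hβ, awgnFilter_denom hβ, eval₂_sub, eval₂_X,
    eval₂_C, eval₂_C]
  simp

/-- Closing the loop reflects the pole in the unit circle: `F / (1 - F)` is `-((β² - 1) / β) / (z -
β⁻¹)`. The Poisson kernel at `β⁻¹` has numerator `1 - β⁻²`, which leaves the factor `β² - 1`. -/
theorem norm_sq_freqResponse_div (hβ : 1 < β) (ω : ℝ) :
    ‖freqResponse (awgnFilter β) ω / (1 - freqResponse (awgnFilter β) ω)‖ ^ 2 =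
      (β ^ 2 - 1) * poissonKernel 0 (β⁻¹ : ℂ) (circleMap 0 1 ω) := by
  have hβ0 : (β : ℂ) ≠ 0 := by exact_mod_cast (by linarith : β ≠ 0)
  have hz : ‖Complex.exp (ω * Complex.I)‖ = 1 := Complex.norm_exp_ofReal_mul_I ω
  have hcm : circleMap 0 1 ω = Complex.exp (ω * Complex.I) := by simp [circleMap]
  rw [freqResponse_awgnFilter hβ, poissonKernel_def, hcm]
  set z := Complex.exp (ω * Complex.I)
  have hzβ : z - β ≠ 0 := fun h => by
    rw [sub_eq_zero.1 h, Complex.norm_real, Real.norm_of_nonneg (by linarith)] at hz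
    linarith
  have hβn : ‖(β : ℂ)‖ = β := by rw [Complex.norm_real, Real.norm_of_nonneg (by linarith)]
  have h1 : 1 - -(((β : ℂ) ^ 2 - 1) / β) / (z - β) = (z - (β : ℂ)⁻¹) / (z - β) := by
    field_simp
    ring
  have hn : ‖((β : ℂ) ^ 2 - 1)‖ = β ^ 2 - 1 := by
    rw [show ((β : ℂ) ^ 2 - 1) = ((β ^ 2 - 1 : ℝ) : ℂ) by push_cast; rfl, Complex.norm_real,
      Real.norm_of_nonneg (by nlinarith)]
  rw [h1, div_div_div_cancel_right₀ hzβ, norm_div, norm_neg, norm_div, hn, hβn]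
  simp only [sub_zero, norm_inv, hβn, hz]
  have : 0 < β := by linarith
  rw [div_pow, div_pow]
  field_simp

/-- The Poisson formula for the constant function one, moved from `[0, 2π]` to `[-π, π]` by
periodicity. -/
theorem integral_poissonKernel_zero_one {w : ℂ} (hw : ‖w‖ < 1) :
    ∫ θ in (-Real.pi)..Real.pi, poissonKernel 0 w (circleMap 0 1 θ) = 2 * Real.pi := by
  have h := (diffContOnCl_const (c := (1 : ℂ)) (𝕜 := ℂ)).circleAverage_poissonKernel_smul
    (c := 0) (R := 1) (mem_ball_zero_iff.2 hw)
  rw [Real.circleAverage_def] at h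
  simp only [Pi.smul_apply', Complex.real_smul, mul_one] at h
  rw [intervalIntegral.integral_ofReal, ← Complex.ofReal_mul, Complex.ofReal_eq_one,
    inv_mul_eq_one₀ (by positivity)] at h
  have hper : Function.Periodic (fun θ => poissonKernel 0 w (circleMap 0 1 θ)) (2 * Real.pi) :=
    fun θ => by simp only [periodic_circleMap 0 1 θ]
  have h2 := hper.intervalIntegral_add_eq (-Real.pi) 0
  rw [show -Real.pi + 2 * Real.pi = Real.pi by ring, zero_add, ← h] at h2
  exact h2

theorem filterPower_awgnFilter (hβ : 1 < β) :
    filterPower (awgnFilter β) (fun _ => 1) = β ^ 2 - 1 := by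
  have hw : ‖(β⁻¹ : ℂ)‖ < 1 := by
    rw [norm_inv, Complex.norm_real, Real.norm_of_nonneg (by linarith)]
    exact inv_lt_one_of_one_lt₀ hβ
  rw [filterPower]
  simp only [mul_one, norm_sq_freqResponse_div hβ]
  rw [intervalIntegral.integral_const_mul, integral_poissonKernel_zero_one hw]
  field_simp

end Filter

/-! ## Scalar LTI encoders -/

namespace LTISystem

theorem transfer_eq (σ : LTISystem 1) : σ.transfer =
    RatFunc.C (σ.c 0 * σ.b 0) / (RatFunc.X - RatFunc.C (σ.A 0 0)) := by
  rw [transfer, Matrix.inv_subsingleton]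
  simp only [dotProduct, Matrix.mulVec_diagonal, Fin.sum_univ_one, Matrix.sub_apply,
    Matrix.scalar_apply, Matrix.diagonal_apply_eq, Matrix.map_apply, Ring.inverse_eq_inv', map_mul]
  ring

/-- The factor `A` appears because index `0` is channel use one, one state update after the initial
state. -/
theorem symbol_zero (σ : LTISystem 1) (s₀ : Fin 1 → ℝ) (y : Fin 0 → ℝ) :
    σ.symbol s₀ 0 y = σ.A 0 0 * (σ.c 0 * s₀ 0) := by
  simp only [symbol, state, dotProduct, Matrix.mulVec, Fin.sum_univ_one]
  ring

theorem symbol_eq_linearSymbol (σ : LTISystem 1) (s₀ : Fin 1 → ℝ) (i : ℕ) (y : Fin i → ℝ) :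
    σ.symbol s₀ i y =
      linearSymbol (σ.A 0 0) (-(σ.c 0 * σ.b 0)) (σ.A 0 0 * (σ.c 0 * s₀ 0)) i y := by
  induction i with
  | zero => exact σ.symbol_zero s₀ y
  | succ i ih =>
    rw [linearSymbol, ← ih]
    simp only [symbol, state, dotProduct, Matrix.mulVec, Fin.sum_univ_one, Pi.add_apply,
      Pi.smul_apply, smul_eq_mul]
    ring

variable {P : ℝ}

/-- The transfer function determines the pole `A` and only the product `c b`; the freedom left in
`c` is absorbed into the slope and offset of the first symbol. -/
theorem isRealization_iff (hP : 0 < P) (σ : LTISystem 1) (p q : Fin 1 → ℝ) :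
    σ.IsRealization p q (awgnFilter √(1 + P)) P ↔
      (σ.A 0 0 = √(1 + P) ∧ -(σ.c 0 * σ.b 0) = P / √(1 + P)) ∧ p 0 ≠ 0 ∧
      ∫ m : UnitMsg, (√(1 + P) * σ.c 0 * p 0 * (m : ℝ) + √(1 + P) * σ.c 0 * q 0) ^ 2
        ∂unitLaw = P := by
  have hβ : 1 < √(1 + P) := Real.lt_sqrt_of_sq_lt (by linarith)
  have hκ : -((√(1 + P) ^ 2 - 1) / √(1 + P)) = -(P / √(1 + P)) := by
    rw [Real.sq_sqrt (by linarith), add_sub_cancel_left]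
  have hp : p ≠ 0 ↔ p 0 ≠ 0 := not_congr ⟨fun h => by rw [h]; rfl,
    fun h => funext fun i => by rw [Subsingleton.elim i 0]; exact h⟩
  rw [IsRealization, transfer_eq, awgnFilter_eq,
    C_div_X_sub_C_eq_iff (awgnFilter_gain_ne_zero hβ), hκ, hp, ← neg_eq_iff_eq_neg,
    and_comm (a := -(σ.c 0 * σ.b 0) = _)]
  refine and_congr_right fun h => and_congr_right fun _ => ?_
  simp only [symbol_zero, h.1, Pi.add_apply, Pi.smul_apply, smul_eq_mul]
  refine Eq.congr_left (integral_congr_ae (ae_of_all _ fun m => ?_))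
  ring

theorem symbol_of_isRealization (hP : 0 < P) {σ : LTISystem 1} {p q : Fin 1 → ℝ}
    (h : σ.IsRealization p q (awgnFilter √(1 + P)) P) (m : ℝ) (i : ℕ) (y : Fin i → ℝ) :
    σ.symbol (m • p + q) i y = linearSymbol √(1 + P) (P / √(1 + P))
      (√(1 + P) * σ.c 0 * p 0 * m + √(1 + P) * σ.c 0 * q 0) i y := by
  obtain ⟨⟨h1, h2⟩, -, -⟩ := (isRealization_iff hP σ p q).1 h
  rw [symbol_eq_linearSymbol, h1, h2]
  congr 1
  simp only [Pi.add_apply, Pi.smul_apply, smul_eq_mul]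
  ring

theorem IsRealization.slope_ne_zero (hP : 0 < P) {σ : LTISystem 1} {p q : Fin 1 → ℝ}
    (h : σ.IsRealization p q (awgnFilter √(1 + P)) P) : √(1 + P) * σ.c 0 * p 0 ≠ 0 := by
  obtain ⟨⟨-, h2⟩, hp, -⟩ := (isRealization_iff hP σ p q).1 h
  have hβ : 0 < √(1 + P) := Real.sqrt_pos.2 (by linarith)
  have hc : σ.c 0 ≠ 0 := fun hc => by
    rw [hc, zero_mul, neg_zero] at h2
    exact (div_pos hP hβ).ne h2
  exact mul_ne_zero (mul_ne_zero hβ.ne' hc) hp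

theorem IsRealization.isLinear (hP : 0 < P) {σ : LTISystem 1} {p q : Fin 1 → ℝ}
    (h : σ.IsRealization p q (awgnFilter √(1 + P)) P) (n : ℕ) :
    (σ.encoder p q n).IsLinear √(1 + P) (P / √(1 + P))
      fun m => √(1 + P) * σ.c 0 * p 0 * (m : ℝ) + √(1 + P) * σ.c 0 * q 0 :=
  fun i m y _ => symbol_of_isRealization hP h m i y

/-- Every affine first symbol of power `P` comes from a realization of the filter. -/
theorem exists_isRealization (hP : 0 < P) {a b : ℝ} (ha : a ≠ 0)
    (hab : ∫ m : UnitMsg, (a * (m : ℝ) + b) ^ 2 ∂unitLaw = P) :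
    ∃ (σ : LTISystem 1) (p q : Fin 1 → ℝ), σ.IsRealization p q (awgnFilter √(1 + P)) P ∧
      ∀ (m : ℝ) (i : ℕ) (y : Fin i → ℝ),
        σ.symbol (m • p + q) i y = linearSymbol √(1 + P) (P / √(1 + P)) (a * m + b) i y := by
  have hβ : √(1 + P) ≠ 0 := (Real.sqrt_pos.2 (by linarith)).ne'
  -- Dividing `a` and `b` by `√(1 + P)` below cancels the state update that precedes the first
  -- transmission.
  let σ : LTISystem 1 := ⟨fun _ _ => √(1 + P), fun _ => -(P / √(1 + P)), fun _ => 1⟩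
  let p : Fin 1 → ℝ := fun _ => a / √(1 + P)
  let q : Fin 1 → ℝ := fun _ => b / √(1 + P)
  have hp : √(1 + P) * σ.c 0 * p 0 = a := by simp only [σ, p]; field_simp
  have hq : √(1 + P) * σ.c 0 * q 0 = b := by simp only [σ, q]; field_simp
  have h : σ.IsRealization p q (awgnFilter √(1 + P)) P := by
    rw [isRealization_iff hP, hp, hq]
    exact ⟨⟨rfl, by simp [σ]⟩, div_ne_zero ha hβ, hab⟩
  exact ⟨σ, p, q, h, fun m i y => by rw [symbol_of_isRealization hP h, hp, hq]⟩

end LTISystem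

/-! ## The Schalkwijk-Kailath scheme -/

namespace Encoder

variable {n : ℕ} {P : ℝ}

/-- Every past of the channel outputs occurs for some noise. -/
theorem exists_sample_output_eq {𝓜 : Type} [MeasurableSpace 𝓜] (e : Encoder 𝓜 n) (i : Fin n)
    (m : 𝓜) (y : Fin i → ℝ) (v : Fin n → e.Seed) :
    ∃ z : Fin n → ℝ, ∀ k : Fin i, e.output ⟨k, k.isLt.trans i.isLt⟩ (m, z, v) = y k := by
  -- The noise is the prescribed output minus the symbol the encoder sends after the prescribed
  -- past; values from time `i` on are irrelevant.
  let z : Fin n → ℝ := fun k => if h : (k : ℕ) < i then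
    y ⟨k, h⟩ - e.enc k m (fun l => y ⟨l, l.isLt.trans h⟩) (v k) else 0
  refine ⟨z, fun k => ?_⟩
  induction k using WellFoundedLT.induction with
  | ind k ih =>
    have hy : (fun l : Fin k.val => e.output ⟨l, l.isLt.trans (k.isLt.trans i.isLt)⟩ (m, z, v)) =
        fun l : Fin k.val => y ⟨l, l.isLt.trans k.isLt⟩ :=
      funext fun l => ih ⟨l, l.isLt.trans k.isLt⟩ l.isLt
    rw [output]
    refine (congrArg (fun y' => e.enc ⟨k, k.isLt.trans i.isLt⟩ m y' (v ⟨k, _⟩) +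
      z ⟨k, k.isLt.trans i.isLt⟩) hy).trans ?_
    simp only [z, k.isLt, dif_pos]
    exact add_sub_cancel _ _

/-- The linear MMSE coefficient of the input given the output, at input power `P`. -/
theorem integral_div_integral_output (e : Encoder UnitMsg n) {i : Fin n}
    (h : MemLp (e.input i) 2 (e.law unitLaw))
    (hi : ∫ ω, e.input i ω ^ 2 ∂(e.law unitLaw) = P) :
    (∫ ω, e.input i ω * e.output i ω ∂(e.law unitLaw)) /
      (∫ ω, e.output i ω ^ 2 ∂(e.law unitLaw)) = P / (1 + P) := by
  rw [e.integral_input_mul_output unitLaw h, e.integral_output_sq unitLaw h, hi, add_comm]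

theorem sqrt_mul_sub_div_mul (hP : 0 < P) (x y : ℝ) :
    √(1 + P) * (x - P / (1 + P) * y) = √(1 + P) * x - P / √(1 + P) * y := by
  have h : √(1 + P) * (P / (1 + P)) = P / √(1 + P) := by
    have h1 : √(1 + P) ^ 2 = 1 + P := Real.sq_sqrt (by linarith)
    have h2 : √(1 + P) ≠ 0 := (Real.sqrt_pos.2 (by linarith)).ne'
    conv_lhs => rw [← h1]
    rw [Real.sqrt_sq (Real.sqrt_nonneg _)]
    field_simp
  rw [mul_sub, ← mul_assoc, h]

theorem IsLinear.isSchalkwijkKailath {e : Encoder UnitMsg n} {a b : ℝ} (hP : 0 < P) (ha : a ≠ 0)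
    (h : e.IsLinear √(1 + P) (P / √(1 + P)) fun m => a * (m : ℝ) + b)
    (hab : ∫ m : UnitMsg, (a * (m : ℝ) + b) ^ 2 ∂unitLaw = P) : e.IsSchalkwijkKailath P := by
  refine ⟨⟨a, b, ha, hab, fun h0 ω => ?_⟩, fun i hi ω => ?_⟩
  · rw [h.input_eq]; rfl
  · have hin := h.input_eq ⟨i, Nat.lt_of_succ_lt hi⟩
    obtain ⟨h1, h2⟩ := h.memLp_and_integral_sq hP unitLaw (memLp_affine_unitLaw a b) i
      (Nat.lt_of_succ_lt hi).le
    rw [hab, sub_self, zero_div, add_zero, ← hin] at h2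
    rw [← hin] at h1
    rw [e.integral_div_integral_output h1 h2, sqrt_mul_sub_div_mul hP, h.input_eq, hin]
    rfl

theorem IsSchalkwijkKailath.exists_input_eq {e : Encoder UnitMsg n} (hP : 0 < P)
    (h : e.IsSchalkwijkKailath P) : ∃ a b : ℝ, a ≠ 0 ∧
      ∫ m : UnitMsg, (a * (m : ℝ) + b) ^ 2 ∂unitLaw = P ∧ ∀ (i : ℕ) (hi : i < n) (ω : e.Sample),
        e.input ⟨i, hi⟩ ω =
          e.linearInput √(1 + P) (P / √(1 + P)) (fun m => a * (m : ℝ) + b) i hi.le ω := by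
  obtain ⟨⟨a, b, ha, hab, h0⟩, hsucc⟩ := h
  refine ⟨a, b, ha, hab, fun i => ?_⟩
  induction i using Nat.strong_induction_on with
  | h i ih =>
    intro hi ω
    cases i with
    | zero => exact h0 hi ω
    | succ i =>
      have hin := funext (ih i i.lt_succ_self (Nat.lt_of_succ_lt hi))
      -- So far only the symbols up to index `i` are known to be linear. That suffices for their
      -- power to be `P`, which fixes the MMSE coefficient in the next step.
      obtain ⟨h1, h2⟩ := e.memLp_and_integral_linearInput_sq hP unitLaw
        (memLp_affine_unitLaw a b) i (Nat.lt_of_succ_lt hi).le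
        fun j hj => funext (ih j (hj.trans i.lt_succ_self) _)
      rw [hab, sub_self, zero_div, add_zero, ← hin] at h2
      rw [← hin] at h1
      rw [hsucc i hi ω, e.integral_div_integral_output h1 h2, sqrt_mul_sub_div_mul hP,
        linearInput_succ, hin]

/-- The scheme constrains inputs along sample points, whereas `IsLinear` concerns the encoding
functions at all arguments. Since any output past is produced by some noise, the former determines
the latter. -/
theorem IsSchalkwijkKailath.exists_isLinear {e : Encoder UnitMsg n} (hP : 0 < P)
    (h : e.IsSchalkwijkKailath P) : ∃ a b : ℝ, a ≠ 0 ∧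
      ∫ m : UnitMsg, (a * (m : ℝ) + b) ^ 2 ∂unitLaw = P ∧
      e.IsLinear √(1 + P) (P / √(1 + P)) fun m => a * (m : ℝ) + b := by
  obtain ⟨a, b, ha, hab, hin⟩ := h.exists_input_eq hP
  refine ⟨a, b, ha, hab, fun i m y v => ?_⟩
  obtain ⟨z, hz⟩ := e.exists_sample_output_eq i m y fun _ => v
  have h1 := hin i i.isLt (m, z, fun _ => v)
  have hy : (fun k : Fin i => e.output ⟨k, k.isLt.trans i.isLt⟩ (m, z, fun _ => v)) = y :=
    funext hz
  unfold input linearInput at h1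
  simp only [hy] at h1
  exact h1

end Encoder

end AWGNFeedback

/-! ### Assembly of the result -/

theorem corollary3 (P β : ℝ) (F : RatFunc ℝ) (hP : 0 < P) (hβ : β = Real.sqrt (1 + P))
    (hF : F = AWGNFeedback.awgnFilter β) :
    -- the filter: one pole, at `β > 1`, and the power constraint with equality
    1 < β ∧ AWGNFeedback.IsStrictlyCausal F ∧ AWGNFeedback.poles F = {(β : ℂ)} ∧
    AWGNFeedback.filterPower F (fun _ => 1) = P ∧
    -- the capacities
    AWGNFeedback.mmseCapacity P = AWGNFeedback.feedbackCapacity P ∧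
    AWGNFeedback.feedbackCapacity P = ((1 / 2 * Real.logb 2 (1 + P) : ℝ) : EReal) ∧
    AWGNFeedback.mmseCapacity P = (AWGNFeedback.instability F : EReal) ∧
    -- the filter, used as an LTI encoder, achieves the MMSE capacity
    (∃ (σ : AWGNFeedback.LTISystem 1) (p q : Fin 1 → ℝ), σ.IsRealization p q F P) ∧
    (∀ (σ : AWGNFeedback.LTISystem 1) (p q : Fin 1 → ℝ), σ.IsRealization p q F P →
      (∀ (n : ℕ) (i : Fin n),
        (σ.encoder p q n).inputPower AWGNFeedback.unitLaw i = ENNReal.ofReal P) ∧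
      (∀ n : ℕ, (σ.encoder p q n).MeetsPower AWGNFeedback.unitLaw P) ∧
      ∃ φ : ∀ n : ℕ, AWGNFeedback.Decoder AWGNFeedback.UnitMsg n,
        AWGNFeedback.mmseCapacity P ≤ Filter.liminf
          (fun n => (AWGNFeedback.mseExponent (σ.encoder p q n) (φ n) : EReal)) Filter.atTop) ∧
    -- it coincides with the Schalkwijk-Kailath scheme
    (∀ (n : ℕ) (e : AWGNFeedback.Encoder AWGNFeedback.UnitMsg n),
      e.IsSchalkwijkKailath P ↔
        ∃ (σ : AWGNFeedback.LTISystem 1) (p q : Fin 1 → ℝ), σ.IsRealization p q F P ∧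
          ∀ (i : Fin n) (m : AWGNFeedback.UnitMsg) (y : Fin i → ℝ) (v : e.Seed),
            e.enc i m y v = σ.symbol ((m : ℝ) • p + q) i y) := by
  subst hβ hF
  have hβ : 1 < √(1 + P) := Real.lt_sqrt_of_sq_lt (by linarith)
  have hinst : AWGNFeedback.instability (AWGNFeedback.awgnFilter √(1 + P)) = 1 / 2 * Real.logb 2 (1 + P) := by
    rw [AWGNFeedback.instability_awgnFilter hβ, Real.sqrt_eq_rpow, Real.logb_rpow_eq_mul_logb_of_pos (by linarith)]
  refine ⟨hβ, AWGNFeedback.isStrictlyCausal_awgnFilter hβ, AWGNFeedback.poles_awgnFilter hβ, ?_,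
    (AWGNFeedback.mmseCapacity_eq hP).trans (AWGNFeedback.feedbackCapacity_eq hP).symm, AWGNFeedback.feedbackCapacity_eq hP, ?_, ?_,
    fun σ p q h => ?_, fun n e => ⟨fun h => ?_, ?_⟩⟩
  · rw [AWGNFeedback.filterPower_awgnFilter hβ, Real.sq_sqrt (by linarith), add_sub_cancel_left]
  · rw [hinst, AWGNFeedback.mmseCapacity_eq hP]
  · obtain ⟨σ, p, q, h, -⟩ := AWGNFeedback.LTISystem.exists_isRealization hP
      (Real.sqrt_ne_zero'.2 (by positivity)) (AWGNFeedback.integral_unitLaw_sqrt_mul_sq hP)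
    exact ⟨σ, p, q, h⟩
  · have hlin := AWGNFeedback.LTISystem.IsRealization.isLinear hP h
    obtain ⟨-, -, hab⟩ := (AWGNFeedback.LTISystem.isRealization_iff hP σ p q).1 h
    refine ⟨fun n i => ?_, fun n => (hlin n).meetsPower hP AWGNFeedback.unitLaw (AWGNFeedback.memLp_affine_unitLaw _ _) hab.le,
      ?_⟩
    · rw [(hlin n).inputPower_eq hP AWGNFeedback.unitLaw (AWGNFeedback.memLp_affine_unitLaw _ _), hab, sub_self, zero_div,
        add_zero]
    · rw [AWGNFeedback.mmseCapacity_eq hP]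
      exact AWGNFeedback.exists_decoders_le_liminf hP (AWGNFeedback.LTISystem.IsRealization.slope_ne_zero hP h) _ hlin hab
  · obtain ⟨a, b, ha, hab, hlin⟩ := h.exists_isLinear hP
    obtain ⟨σ, p, q, hσ, hsym⟩ := AWGNFeedback.LTISystem.exists_isRealization hP ha hab
    exact ⟨σ, p, q, hσ, fun i m y v => (hlin i m y v).trans (hsym m i y).symm⟩
  · rintro ⟨σ, p, q, h, henc⟩
    obtain ⟨-, -, hab⟩ := (AWGNFeedback.LTISystem.isRealization_iff hP σ p q).1 h
    exact AWGNFeedback.Encoder.IsLinear.isSchalkwijkKailath hP (AWGNFeedback.LTISystem.IsRealization.slope_ne_zero hP h)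
      (fun i m y v => (henc i m y v).trans (AWGNFeedback.LTISystem.symbol_of_isRealization hP h m i y)) hab
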